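/- Let $k$ be a field of characteristic zero. **Calabi–Yau categories.** A ($\mathbb Z$-graded, $k$-linear) $A_\infty$-category $\mathcal C$ is given by objects, graded vector spaces $\mathrm{Hom}_{\mathcal C}(x,y)$, and degree $1$ maps $$b_t:\mathrm{Hom}(x_{t-1},x_t)[1]\otimes\cdots\otimes\mathrm{Hom}(x_0,x_1)[1]\to\mathrm{Hom}(x_0,x_t)[1]\qquad(t\ge 1)$$ with $\sum_{a+j+c=t} b_{a+1+c}(\mathrm{id}^{\otimes a}\otimes b_j\otimes \mathrm{id}^{\otimes c})=0$ for all $t\geq 1$ (Koszul signs are understood; $V[m]^d=V^{d+m}$). A *Calabi–Yau category of dimension $n$* is an $A_\infty$-category together with degree $0$ pairings $\langle\bullet,\bullet\rangle:\mathrm{Hom}(x,y)\otimes\mathrm{Hom}(y,x)\to k[-n]$ for all objects $x,y$ such that 1. they are nondegenerate: they induce isomorphisms $\mathrm{Hom}^i(x,y)\cong(\mathrm{Hom}^{n-i}(y,x))^*$ and $\mathrm{Hom}^{n-i}(y,x)\cong(\mathrm{Hom}^{i}(x,y))^*$ for all $i$; 2. they are symmetric: $\langle f,g\rangle=(-1)^{|f||g|}\langle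 g,f\rangle$; 3. for all $N\ge 2$ the functionals $W_N=\frac1N\langle\bullet,\bullet\rangle(b_{N-1}\otimes\mathrm{id})$ on $\mathrm{Hom}(x_{N-1},x_0)[1]\otimes\cdots\otimes\mathrm{Hom}(x_0,x_1)[1]$ are invariant under cyclic rotation of the factors (with Koszul sign), where the pairing on shifted spaces is $\langle Sf,Sg\rangle=(-1)^{|f|}\langle f,g\rangle$, $S:\mathrm{Hom}\to\mathrm{Hom}[1]$ being the degree $-1$ identity map. **Twisted objects.** Let $\mathcal C^{\mathrm{op}}$ be the opposite $A_\infty$-category, $b_t^{\mathrm{op}}=(-1)^{t-1}\,b_t\circ(\text{reversal of the factors, with Koszul sign})$. For an $A_\infty$-category $\mathcal D$ let $\mathcal D[\mathbb Z]$ be the $A_\infty$-category of formal shifts $x[m]$ ($x\in\mathcal D$, $m\in\mathbb Z$), with $\mathrm{Hom}(x[m],y[m'])=\mathrm{Hom}(x,y)[m'-m]$; its elements are written $S^{m'}\varphi S^{-m}$ with $\varphi\in \mathrm{Hom}(x,y)$, and in terms of the unshifted operations $m_t=S^{-1}b_tS^{\otimes t}$ one has $m_t(S^{m_t}\varphi_tS^{-m_{t-1}},\dots,S^{m_1}\varphi_1S^{-m_0})=(-1)^{t\,m_t}S^{m_t}m_t(\varphi_t,\dots,\varphi_1)S^{-m_0}$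 (where the exponents $m_0,\dots,m_t$ are integers). Put $h_{\mathcal C}[\mathbb Z]=\mathcal C[\mathbb Z]$ and $h^{\mathcal C}[\mathbb Z]=\mathcal C^{\mathrm{op}}[\mathbb Z]$; these are the categories of shifts of representable right, respectively left, $\mathcal C$-modules. Operations on composable matrices of morphisms are defined by $b_t(M_t,\dots,M_1)_{ij}=\sum_{q_1,\dots,q_{t-1}}b_t((M_t)_{i,q_{t-1}},\dots,(M_1)_{q_1,j})$. An object of $\mathrm{tw}_r(\mathcal C)$ (respectively $\mathrm{tw}_l(\mathcal C)$) is a nonempty finite tuple $(z_1,\dots,z_p)$ of objects of $h_{\mathcal C}[\mathbb Z]$ (respectively $h^{\mathcal C}[\mathbb Z]$) with a strictly upper-triangular (respectively strictly lower-triangular) $p\times p$ matrix $A$ of degree $1$ morphisms, $A_{ij}:z_j\to z_i$, such that $\sum_{i\ge1}b_i(A,\dots,A)=0$. Morphisms between two such objects are matrices of morphisms between the tuples, and for $M_i:(\tau_{i-1},A_{i-1})\to(\tau_i,A_i)$ $$b_{\mathrm{tw},t}(M_t,\dots,M_1)=\sum_{p_0,\dots,p_t\ge0}b_{t+\sum p_i}(A_t^{\otimes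 p_t},M_t,A_{t-1}^{\otimes p_{t-1}},\dots,M_1,A_0^{\otimes p_0}),$$ a finite sum by triangularity. **Theorem.** Let $n\in\mathbb Z$ and let $\mathcal C$ be a Calabi–Yau category of dimension $n$. Then $\mathrm{tw}_l(\mathcal C)$ and $\mathrm{tw}_r(\mathcal C)$ are $A_\infty$-categories and, with the trace pairing $$\langle M',M\rangle=\sum_{a,c}\langle M'_{a,c},M_{c,a}\rangle ,$$ they are Calabi–Yau categories of dimension $n$. Here the pairing on entries is the one induced on shifts, $\langle S^{m}\psi S^{-m'},S^{m'}\varphi S^{-m}\rangle=(-1)^{m(n+1)}\langle\psi,\varphi\rangle$, where for $\mathcal C^{\mathrm{op}}$ the pairing $\langle\psi,\varphi\rangle$ is that of $\mathcal C$. -/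

import Mathlib

/-!
Conventions. Everything is over a field `k`. A graded vector space is a family of vector spaces indexed
by `ℤ` (cohomological grading), and `V[m]` has `V[m]ᵈ = Vᵈ⁺ᵐ`. The operations of an `A∞`-category are
recorded in the "shifted" form `b_t : Hom[1] ⊗ ⋯ ⊗ Hom[1] → Hom[1]`, all of degree `1`, so that the
compatibility relations carry the Koszul signs only. An element of `Hom(x, y)[1]` is written as the
corresponding element `f` of `Hom(x, y)ᵈ`; its degree as an element of `Hom(x, y)[1]` is `d - 1`.
-/

universe w u v

section Chains

variable {Ob : Type u}

/-- A composable sequence `(f_t, …, f_1)` of homogeneous morphisms from `x` to `y`. As in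
`Hom(x_{t-1}, x_t) ⊗ ⋯ ⊗ Hom(x_0, x_1)` the morphism that is applied last stands leftmost. -/
inductive Chain (Hom : Ob → Ob → ℤ → Type v) : Ob → Ob → Type (max u v)
  | nil (x : Ob) : Chain Hom x x
  | cons {x y z : Ob} {d : ℤ} (f : Hom y z d) (p : Chain Hom x y) : Chain Hom x z

namespace Chain

variable {Hom : Ob → Ob → ℤ → Type v}

/-- The number of morphisms in the sequence. -/
def length {x y : Ob} : Chain Hom x y → ℕ
  | nil _ => 0
  | cons _ p => p.length + 1

/-- The degree of `f_t ⊗ ⋯ ⊗ f_1` in `Hom[1] ⊗ ⋯ ⊗ Hom[1]`, that is `∑ (d_i - 1)`. -/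
def deg {x y : Ob} : Chain Hom x y → ℤ
  | nil _ => 0
  | cons (d := d) _ p => (d - 1) + p.deg

/-- Concatenation, with the sequence applied last on the left. -/
def append {x y z : Ob} : Chain Hom y z → Chain Hom x y → Chain Hom x z
  | nil _, q => q
  | cons f p, q => cons f (p.append q)

/-- `(f_t, …, f_1) ↦ (f_t, …, f_1, g)`. -/
def snoc {x y z : Ob} {d : ℤ} (p : Chain Hom y z) (g : Hom x y d) : Chain Hom x z :=
  p.append (cons g (nil x))

/-- All ways of writing a sequence as a concatenation `l ++ r`; either part may be empty. -/
def splits {x y : Ob} : Chain Hom x y → List (Σ u : Ob, Chain Hom u y × Chain Hom x u)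
  | nil x => [⟨x, nil x, nil x⟩]
  | cons f p =>
      ⟨_, nil _, cons f p⟩ :: p.splits.map fun s => ⟨s.1, cons f s.2.1, s.2.2⟩

/-- The sequence `(A, …, A)` with `i` entries, for `A` an endomorphism. -/
def rep {x : Ob} {d : ℤ} (A : Hom x x d) : ℕ → Chain Hom x x
  | 0 => nil x
  | i + 1 => cons A (rep A i)

/-- The exponent `∑_{i < j} (d_i - 1) (d_j - 1)` of the Koszul sign of the reversal of
`f_t ⊗ ⋯ ⊗ f_1` in `Hom[1] ⊗ ⋯ ⊗ Hom[1]`. -/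
def revExp {x y : Ob} : Chain Hom x y → ℤ
  | nil _ => 0
  | cons (d := d) _ p => (d - 1) * p.deg + p.revExp

/-- The reversed sequence, as a sequence for the opposite family of morphism spaces. -/
def unop {x y : Ob} : Chain (fun x y d => Hom y x d) x y → Chain Hom y x
  | nil x => nil x
  | cons f p => p.unop.snoc f

end Chain

end Chains

/-- The data underlying an `A∞`-category: objects, graded spaces of morphisms, operations. For a
composable sequence `p = (f_t, …, f_1)` the element `b p e` is the component of `b_t(f_t, …, f_1)`
in `Hom(x, y)ᵉ`. The laws are in `AInfData.IsAInf`. -/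
structure AInfData (k : Type w) [Field k] where
  Ob : Type u
  Hom : Ob → Ob → ℤ → Type v
  [addCommGroup : ∀ x y d, AddCommGroup (Hom x y d)]
  [module : ∀ x y d, Module k (Hom x y d)]
  b : ∀ {x y : Ob}, Chain Hom x y → ∀ e : ℤ, Hom x y e

attribute [instance] AInfData.addCommGroup AInfData.module

namespace AInfData

variable {k : Type w} [Field k]

/-- The laws of an `A∞`-category. -/
structure IsAInf (C : AInfData.{w, u, v} k) : Prop where
  /-- There is no operation `b_0`. -/
  b_nil : ∀ (x : C.Ob) (e : ℤ), C.b (Chain.nil x) e = 0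
  /-- `b_t : Hom[1] ⊗ ⋯ ⊗ Hom[1] → Hom[1]` has degree `1`. -/
  b_degree : ∀ {x y : C.Ob} (p : Chain C.Hom x y) (e : ℤ), e - 1 ≠ p.deg + 1 → C.b p e = 0
  /-- `b_t` is linear in each argument. -/
  b_add : ∀ {x y z w : C.Ob} {d : ℤ} (l : Chain C.Hom z w) (f g : C.Hom y z d)
    (r : Chain C.Hom x y) (e : ℤ),
    C.b (l.append (.cons (f + g) r)) e
      = C.b (l.append (.cons f r)) e + C.b (l.append (.cons g r)) e
  b_smul : ∀ {x y z w : C.Ob} {d : ℤ} (l : Chain C.Hom z w) (c : k) (f : C.Hom y z d)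
    (r : Chain C.Hom x y) (e : ℤ),
    C.b (l.append (.cons (c • f) r)) e = c • C.b (l.append (.cons f r)) e
  /-- `∑ b_{a+1+c} (id^{⊗a} ⊗ b_j ⊗ id^{⊗c}) = 0`: the sum over all factorizations
  `p = l ++ m ++ r` of `(-1)^{|l|} b(l, b(m), r)`. By `b_nil` the terms with `m` empty vanish. -/
  relations : ∀ {x y : C.Ob} (p : Chain C.Hom x y) (e : ℤ),
    (p.splits.map fun s => (s.2.2.splits.map fun t =>
      s.2.1.deg.negOnePow •
        C.b (s.2.1.append (.cons (C.b t.2.1 (t.2.1.deg + 2)) t.2.2)) e).sum).sum = 0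

/-- A family of bilinear forms `Hom(x, y) ⊗ Hom(y, x) → k`, given on homogeneous components. -/
abbrev Pairing (C : AInfData.{w, u, v} k) : Type (max u v w) :=
  ∀ (x y : C.Ob) (i j : ℤ), C.Hom x y i →ₗ[k] C.Hom y x j →ₗ[k] k

/-- The form induced on `Hom(x, y)[1] ⊗ Hom(y, x)[1]` through the degree `-1` maps
`S : Hom → Hom[1]`. Since `(S ⊗ S)(f ⊗ g) = (-1)^{|f|} Sf ⊗ Sg`, it takes the value
`(-1)^{|f|} ⟨f, g⟩` on `Sf ⊗ Sg`. -/
def Pairing.shifted {C : AInfData.{w, u, v} k} (P : C.Pairing) {x y : C.Ob} {i j : ℤ}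
    (f : C.Hom x y i) (g : C.Hom y x j) : k :=
  i.negOnePow • P x y i j f g

/-- The functional `W_N = (1/N) ⟨•, •⟩ (b_{N-1} ⊗ id)` on the cyclically composable sequence
`(f, p, g)`, where `N` is the number of its entries and `b_{N-1}` is applied to `(f, p)`. -/
def Pairing.W {C : AInfData.{w, u, v} k} (P : C.Pairing) {x y z : C.Ob} {d e : ℤ}
    (f : C.Hom z x d) (p : Chain C.Hom y z) (g : C.Hom x y e) : k :=
  ((p.length + 2 : ℕ) : k)⁻¹ *
    P.shifted (C.b (.cons f p) ((Chain.cons f p).deg + 2)) g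

/-- `C` with the pairing `P` is a Calabi–Yau category of dimension `n`. -/
structure IsCalabiYau (n : ℤ) (C : AInfData.{w, u, v} k) (P : C.Pairing) : Prop
    extends C.IsAInf where
  /-- The pairing is a graded map to `k[-n]`. -/
  pair_degree : ∀ (x y : C.Ob) (i j : ℤ), i + j ≠ n → P x y i j = 0
  /-- Nondegeneracy: `Hom(x, y)ⁱ` and `Hom(y, x)ⁿ⁻ⁱ` are dual to each other. -/
  nondegenerate : ∀ (x y : C.Ob) (i j : ℤ), i + j = n → (P x y i j).IsPerfPair
  /-- Invariance under the symmetry `f ⊗ g ↦ (-1)^{|f||g|} g ⊗ f`. -/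
  symmetric : ∀ {x y : C.Ob} {i j : ℤ} (f : C.Hom x y i) (g : C.Hom y x j),
    P x y i j f g = (i * j).negOnePow • P y x j i g f
  /-- `W_N = W_N ∘ φ`, where `φ` moves the leftmost factor to the right end, with the Koszul
  sign in `Hom[1] ⊗ ⋯ ⊗ Hom[1]`. The first equation is the case `N = 2`, the second one, where
  the sequence is `(f, h, p, g)`, is the case `N ≥ 3`. -/
  cyclic_two : ∀ {x y : C.Ob} {d e : ℤ} (f : C.Hom y x d) (g : C.Hom x y e),
    P.W f (.nil y) g = ((d - 1) * (e - 1)).negOnePow • P.W g (.nil x) f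
  cyclic : ∀ {x y z z' : C.Ob} {d d' e : ℤ} (f : C.Hom z x d) (h : C.Hom z' z d')
    (p : Chain C.Hom y z') (g : C.Hom x y e),
    P.W f (.cons h p) g
      = ((d - 1) * ((d' - 1) + p.deg + (e - 1))).negOnePow • P.W h (p.snoc g) f

/-! ### The opposite category and the category of shifts -/

/-- The opposite `A∞`-category: `b^op_t(f_t, …, f_1) = (-1)^{t-1} ± b_t(f_1, …, f_t)`, where `±` is the
Koszul sign of the reversal in `Hom[1] ⊗ ⋯ ⊗ Hom[1]`. In terms of the unshifted operations:
`m^op_1 = m_1`, `m^op_2(f, g) = (-1)^{|f||g|} m_2(g, f)`, and generally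
`m^op_t = (-1)^{(t-1)(t-2)/2} m_t ∘ (reversal)`. -/
abbrev op (C : AInfData.{w, u, v} k) : AInfData.{w, u, v} k where
  Ob := C.Ob
  Hom x y d := C.Hom y x d
  b p e := (p.length + 1 + p.revExp : ℤ).negOnePow • C.b p.unop e

/-- The pairing of `C`, as a pairing on the opposite category. -/
def Pairing.op {C : AInfData.{w, u, v} k} (P : C.Pairing) : C.op.Pairing :=
  fun x y i j => P y x i j

/-- Morphisms between shifts: `Hom(x[m], y[m'])` is `Hom(x, y)[m' - m]`. The element given by
`φ ∈ Hom(x, y)` stands for `S^{m'} φ S^{-m}`. -/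
def ShiftHom (C : AInfData.{w, u, v} k) (X Y : C.Ob × ℤ) (d : ℤ) : Type v :=
  C.Hom X.1 Y.1 (d + Y.2 - X.2)

instance (C : AInfData.{w, u, v} k) (X Y : C.Ob × ℤ) (d : ℤ) : AddCommGroup (C.ShiftHom X Y d) :=
  C.addCommGroup X.1 Y.1 (d + Y.2 - X.2)

instance (C : AInfData.{w, u, v} k) (X Y : C.Ob × ℤ) (d : ℤ) : Module k (C.ShiftHom X Y d) :=
  C.module X.1 Y.1 (d + Y.2 - X.2)

/-- `(S^{m_t} φ_t S^{-m_{t-1}}, …, S^{m_1} φ_1 S^{-m_0}) ↦ (φ_t, …, φ_1)`. -/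
def unshift {C : AInfData.{w, u, v} k} :
    ∀ {X Y : C.Ob × ℤ}, Chain C.ShiftHom X Y → Chain C.Hom X.1 Y.1
  | _, _, .nil X => .nil X.1
  | _, _, .cons (y := Y) (z := Z) (d := d) f p =>
      .cons (Hom := C.Hom) (y := Y.1) (z := Z.1) (d := d + Z.2 - Y.2) f (unshift p)

/-- The exponent `m_1 + ⋯ + m_t`. -/
def shiftExp {C : AInfData.{w, u, v} k} {X Y : C.Ob × ℤ} : Chain C.ShiftHom X Y → ℤ
  | .nil _ => 0
  | .cons (z := Z) _ p => Z.2 + shiftExp p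

/-- The `A∞`-category of formal shifts `x[m]` of objects of `C`. The operations are
`m_t(S^{m_t} φ_t S^{-m_{t-1}}, …, S^{m_1} φ_1 S^{-m_0})
  = (-1)^{t m_t} S^{m_t} m_t(φ_t, …, φ_1) S^{-m_0}`
(the degree `2 - t` operation `m_t` moves past `S^{m_t}`). In the shifted form, where
`b_t(Sf_t, …, Sf_1) = (-1)^{∑ (i-1)|f_i|} S m_t(f_t, …, f_1)`, this is the sign
`(-1)^{m_1 + ⋯ + m_t}` below. -/
abbrev shifts (C : AInfData.{w, u, v} k) : AInfData.{w, u, v} k where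
  Ob := C.Ob × ℤ
  Hom := C.ShiftHom
  b {X Y} p e := (shiftExp p).negOnePow • C.b (unshift p) (e + Y.2 - X.2)

/-- The pairing on shifts,
`⟨S^m ψ S^{-m'}, S^{m'} φ S^{-m}⟩ = (-1)^{m (n + 1)} ⟨ψ, φ⟩`;
the sign is the Koszul sign of moving `S^{-m}` cyclically to the front (`ψφ` has degree `n`).
It is trivial for odd `n`. -/
def Pairing.shifts {C : AInfData.{w, u, v} k} (P : C.Pairing) (n : ℤ) : C.shifts.Pairing :=
  fun X Y i j =>
    ((Y.2 * (n + 1)).negOnePow : ℤ) • P X.1 Y.1 (i + Y.2 - X.2) (j + X.2 - Y.2)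

/-! ### Matrices -/

/-- A finite tuple of objects. -/
structure Tuple (D : AInfData.{w, u, v} k) where
  size : ℕ
  obj : Fin size → D.Ob

/-- Matrices of homogeneous morphisms of degree `d`, with columns indexed by the source tuple and rows
by the target tuple. -/
abbrev MatHom (D : AInfData.{w, u, v} k) (X Y : D.Tuple) (d : ℤ) : Type v :=
  ∀ (i : Fin Y.size) (j : Fin X.size), D.Hom (X.obj j) (Y.obj i) d

/-- For a composable sequence of matrices `(M_t, …, M_1)`, the sum over all `q_{t-1}, …, q_1` of `F`
applied to `((M_t)_{i, q_{t-1}}, (M_{t-1})_{q_{t-1}, q_{t-2}}, …, (M_1)_{q_1, j})`. -/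
def entrySum {D : AInfData.{w, u, v} k} {V : Type v} [AddCommGroup V] :
    ∀ {X Y : D.Tuple}, Chain D.MatHom X Y → (i : Fin Y.size) → (j : Fin X.size) →
      (Chain D.Hom (X.obj j) (Y.obj i) → V) → V
  | _, _, .nil X, i, j, F => if h : i = j then F (h ▸ .nil (X.obj i)) else 0
  | _, _, .cons (y := Y) M P, i, j, F =>
      ∑ q : Fin Y.size, entrySum P q j fun c => F (.cons (M i q) c)

/-- Operations on matrices:
`b_t(M_t, …, M_1)_{ij} = ∑ b_t((M_t)_{i, q_{t-1}}, …, (M_1)_{q_1, j})`. -/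
def matB {D : AInfData.{w, u, v} k} {X Y : D.Tuple} (P : Chain D.MatHom X Y) (e : ℤ) :
    D.MatHom X Y e :=
  fun i j => entrySum P i j fun c => D.b c e

/-! ### Twisted objects -/

/-- A twisted object: a nonempty tuple of objects of `D` and a degree `1` endomorphism matrix `A` of
it, with `A i j = 0` unless `R i j`, such that `∑_{i ≥ 1} b_i(A, …, A) = 0`. We use `<` for `R`
(strictly upper-triangular) or `>` (strictly lower-triangular). For such an `A` every product of `size`
or more entries `A_{i q} A_{q q'} ⋯` along a path of indices contains a zero, so that the
sum stops. -/
structure TwObj (D : AInfData.{w, u, v} k) (R : ℕ → ℕ → Prop) where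
  tuple : D.Tuple
  pos : 0 < tuple.size
  A : D.MatHom tuple tuple 1
  triangular : ∀ i j : Fin tuple.size, ¬ R i j → A i j = 0
  maurerCartan : ∑ i ∈ Finset.Icc 1 tuple.size, matB (Chain.rep A i) 2 = 0

/-- Morphisms of twisted objects are matrices. -/
abbrev TwHom (D : AInfData.{w, u, v} k) (R : ℕ → ℕ → Prop) (T T' : D.TwObj R) (d : ℤ) :
    Type v :=
  D.MatHom T.tuple T'.tuple d

/-- For a composable sequence `(M_t, …, M_1)` of morphisms `M_i : T_{i-1} → T_i` of twisted objects,
the sum over all `p_0, …, p_t ≥ 0` of `F(A_t^{⊗p_t}, M_t, A_{t-1}^{⊗p_{t-1}}, …, M_1, A_0^{⊗p_0})`.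
Only `p_i ≤ size T_i` is needed since `A_i` is strictly triangular. -/
def insertSum {D : AInfData.{w, u, v} k} {R : ℕ → ℕ → Prop}
    {V : Type v} [AddCommGroup V] :
    ∀ {T T' : D.TwObj R},
      Chain (D.TwHom R) T T' → (Chain D.MatHom T.tuple T'.tuple → V) → V
  | _, _, .nil T, F => ∑ p ∈ Finset.range (T.tuple.size + 1), F (Chain.rep T.A p)
  | _, _, .cons (z := T') M P, F =>
      ∑ p ∈ Finset.range (T'.tuple.size + 1),
        insertSum P fun c => F ((Chain.rep T'.A p).append (.cons M c))

/-- Twisted objects over `D`, with the operations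
`b_t(M_t, …, M_1) = ∑_{p_0, …, p_t ≥ 0} b(A_t^{⊗p_t}, M_t, A_{t-1}^{⊗p_{t-1}}, …, M_1, A_0^{⊗p_0})`.
(For `t = 0` the right hand side is `∑ b_i(A, …, A)`, which is zero.) -/
abbrev tw (D : AInfData.{w, u, v} k) (R : ℕ → ℕ → Prop) : AInfData.{w, max u v, v} k where
  Ob := D.TwObj R
  Hom := D.TwHom R
  b P e := insertSum P fun c => matB c e

/-- The trace pairing on matrices, `⟨M', M⟩ = ∑_{a, c} ⟨M'_{a c}, M_{c a}⟩`. -/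
def Pairing.traceForm {D : AInfData.{w, u, v} k} (P : D.Pairing) (X Y : D.Tuple) (i j : ℤ) :
    D.MatHom X Y i →ₗ[k] D.MatHom Y X j →ₗ[k] k :=
  LinearMap.mk₂ k
    (fun M' M => ∑ a : Fin Y.size, ∑ c : Fin X.size,
      P (X.obj c) (Y.obj a) i j (M' a c) (M c a))
    (fun _ _ _ => by simp [Finset.sum_add_distrib])
    (fun _ _ _ => by simp [Finset.mul_sum])
    (fun _ _ _ => by simp [Finset.sum_add_distrib])
    (fun _ _ _ => by simp [Finset.mul_sum])

/-- The trace pairing as a pairing on twisted objects. -/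
def Pairing.trace {D : AInfData.{w, u, v} k} (P : D.Pairing) (R : ℕ → ℕ → Prop) :
    (D.tw R).Pairing :=
  fun T T' i j => P.traceForm T.tuple T'.tuple i j

/-- `tw_r(C)`: objects are tuples of shifts of the representable right modules `h_x`, with strictly
upper-triangular matrices. As an `A∞`-category that of the `h_x` is `C`. -/
abbrev twRight (C : AInfData.{w, u, v} k) : AInfData.{w, max u v, v} k := C.shifts.tw (· < ·)

/-- `tw_l(C)`: objects are tuples of shifts of the representable left modules `h^x`, with strictly
lower-triangular matrices. As an `A∞`-category that of the `h^x` is `C^op`, and a morphism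
`h^y[m] → h^x[m']` is `S^{m'} h^φ S^{-m}` for `φ ∈ Hom(x, y)`. -/
abbrev twLeft (C : AInfData.{w, u, v} k) : AInfData.{w, max u v, v} k := C.op.shifts.tw (· > ·)

/-- The trace pairing on `tw_r(C)`. -/
def Pairing.twRight {C : AInfData.{w, u, v} k} (P : C.Pairing) (n : ℤ) : C.twRight.Pairing :=
  (P.shifts n).trace (· < ·)

/-- The trace pairing on `tw_l(C)`. -/
def Pairing.twLeft {C : AInfData.{w, u, v} k} (P : C.Pairing) (n : ℤ) : C.twLeft.Pairing :=
  (P.op.shifts n).trace (· > ·)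

end AInfData

/-!
Both categories are obtained in two steps from `C`, or from its opposite: adjoin shifts, then pass
to twisted objects. Each step preserves Calabi–Yau structures, which is `IsCalabiYau.op`,
`IsCalabiYau.shifts` and `IsCalabiYau.tw`. Sums over the factorizations `p = l ++ r` of a
composable sequence are handled through `Chain.splitSum`, and cyclic invariance through the
unnormalised functionals `N W_N` (`Pairing.form`), which carry the same information because the
characteristic is zero.

Opposite category and shifts. Every operation is, up to sign, an operation of `C`, so only signs
have to be compared. Reversal exchanges the rotation by one factor with its inverse. For shifts,
the signs need to agree only in total degree `n`; in every other degree both sides vanish.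

Twisted objects. The operations of `D.tw R` on a sequence `P` are sums of the operations of `D`
over all sequences of entries of `(A_t^{⊗p_t}, M_t, …, M_1, A_0^{⊗p_0})`, collected in the
multiset `expand P i j`. The main point is `expand_splitSum`: cutting the expansions of `P` in all
possible ways is the same as cutting `P` and expanding both parts. A cut inside a block `A^{⊗p}`
is the cut of `P` at the object that carries `A`. The bounds `p_i ≤ size` do no harm: nonzero
entries of `A` strictly increase a rank function, so a path through more than `size` entries of
`A` meets a zero entry. Applied twice, this turns the `A∞`-relation of `D.tw R` into a sum of
`A∞`-relations of `D`. Cyclic invariance follows from that of `D` by rotating `(l, f, r, g)` to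
`(r, g, l, f)` (`IsCalabiYau.form_rotate`), where `l` consists of entries of the twisting matrix
and so has degree `0`. Nondegeneracy of the trace form holds because the dual of a finite product
is the product of the duals (`bijective_of_sum_sum`).
-/

/-! ### Composable sequences -/

namespace Chain

variable {Ob : Type u} {Hom : Ob → Ob → ℤ → Type v}

@[simp] theorem nil_append {x y : Ob} (q : Chain Hom x y) : (nil y).append q = q := rfl

@[simp] theorem cons_append {x y z t : Ob} {d : ℤ} (f : Hom z t d) (p : Chain Hom y z)
    (q : Chain Hom x y) : (cons f p).append q = cons f (p.append q) := rfl

@[simp] theorem append_nil {x y : Ob} (p : Chain Hom x y) : p.append (nil x) = p := by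
  induction p with
  | nil => rfl
  | cons f p ih => simp [ih]

theorem append_assoc {x y z t : Ob} (p : Chain Hom z t) (q : Chain Hom y z) (r : Chain Hom x y) :
    (p.append q).append r = p.append (q.append r) := by
  induction p with
  | nil => rfl
  | cons f p ih => simp [ih]

@[simp] theorem deg_nil (x : Ob) : (nil x : Chain Hom x x).deg = 0 := rfl

@[simp] theorem deg_cons {x y z : Ob} {d : ℤ} (f : Hom y z d) (p : Chain Hom x y) :
    (cons f p).deg = d - 1 + p.deg := rfl

@[simp] theorem deg_append {x y z : Ob} (p : Chain Hom y z) (q : Chain Hom x y) :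
    (p.append q).deg = p.deg + q.deg := by
  induction p with
  | nil => simp
  | cons f p ih => simp [ih, add_assoc]

@[simp] theorem length_nil (x : Ob) : (nil x : Chain Hom x x).length = 0 := rfl

@[simp] theorem length_cons {x y z : Ob} {d : ℤ} (f : Hom y z d) (p : Chain Hom x y) :
    (cons f p).length = p.length + 1 := rfl

@[simp] theorem length_append {x y z : Ob} (p : Chain Hom y z) (q : Chain Hom x y) :
    (p.append q).length = p.length + q.length := by
  induction p with
  | nil => simp
  | cons f p ih => simp [ih]; omega

@[simp] theorem revExp_nil (x : Ob) : (nil x : Chain Hom x x).revExp = 0 := rfl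

@[simp] theorem revExp_cons {x y z : Ob} {d : ℤ} (f : Hom y z d) (p : Chain Hom x y) :
    (cons f p).revExp = (d - 1) * p.deg + p.revExp := rfl

@[simp] theorem revExp_append {x y z : Ob} (p : Chain Hom y z) (q : Chain Hom x y) :
    (p.append q).revExp = p.revExp + q.revExp + p.deg * q.deg := by
  induction p with
  | nil => simp
  | cons f p ih => simp [ih]; ring

@[simp] theorem deg_rep {x : Ob} (A : Hom x x 1) (i : ℕ) : (rep A i).deg = 0 := by
  induction i with
  | zero => rfl
  | succ i ih => simp [rep, ih]

/-! ### Sums over the factorizations of a sequence -/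

section SplitSum

variable {V : Type*} [AddCommMonoid V]

/-- The sum of `G l r` over all factorizations `p = l ++ r`. -/
def splitSum {x y : Ob} (p : Chain Hom x y) (G : ∀ u, Chain Hom u y → Chain Hom x u → V) : V :=
  (p.splits.map fun s => G s.1 s.2.1 s.2.2).sum

@[simp] theorem splitSum_nil (x : Ob) (G : ∀ u, Chain Hom u x → Chain Hom x u → V) :
    (nil x).splitSum G = G x (nil x) (nil x) := by
  simp [splitSum, splits]

@[simp] theorem splitSum_cons {x y z : Ob} {d : ℤ} (f : Hom y z d) (p : Chain Hom x y)
    (G : ∀ u, Chain Hom u z → Chain Hom x u → V) :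
    (cons f p).splitSum G = G z (nil z) (cons f p) + p.splitSum fun u l r => G u (cons f l) r := by
  simp [splitSum, splits, Function.comp_def]

theorem splitSum_add {x y : Ob} (p : Chain Hom x y)
    (G G' : ∀ u, Chain Hom u y → Chain Hom x u → V) :
    (p.splitSum fun u l r => G u l r + G' u l r) = p.splitSum G + p.splitSum G' := by
  simp [splitSum, List.sum_map_add]

theorem splitSum_congr {x y : Ob} (p : Chain Hom x y)
    {G G' : ∀ u, Chain Hom u y → Chain Hom x u → V}
    (h : ∀ u l r, l.append r = p → G u l r = G' u l r) : p.splitSum G = p.splitSum G' := by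
  induction p with
  | nil => simpa using h _ (nil _) (nil _) rfl
  | cons f p ih =>
    rw [splitSum_cons, splitSum_cons, h _ _ _ rfl, ih]
    intro u l r hp
    exact h _ _ _ (by simp [hp])

theorem splitSum_eq_zero {x y : Ob} (p : Chain Hom x y)
    {G : ∀ u, Chain Hom u y → Chain Hom x u → V}
    (h : ∀ u l r, l.append r = p → G u l r = 0) : p.splitSum G = 0 := by
  rw [splitSum_congr p h]
  simp [splitSum]

theorem map_splitSum {W F : Type*} [AddCommMonoid W] [FunLike F V W] [AddMonoidHomClass F V W]
    (φ : F) {x y : Ob} (p : Chain Hom x y) (G : ∀ u, Chain Hom u y → Chain Hom x u → V) :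
    φ (p.splitSum G) = p.splitSum fun u l r => φ (G u l r) := by
  simp [splitSum, map_list_sum, Function.comp_def]

theorem smul_splitSum {M W : Type*} [AddCommMonoid W] [DistribSMul M W] (c : M) {x y : Ob}
    (p : Chain Hom x y) (G : ∀ u, Chain Hom u y → Chain Hom x u → W) :
    c • p.splitSum G = p.splitSum fun u l r => c • G u l r :=
  map_splitSum (DistribSMul.toAddMonoidHom W c) p G

theorem splitSum_append_cons {x y z t : Ob} {d : ℤ} (p : Chain Hom z t) (f : Hom y z d)
    (q : Chain Hom x y) (G : ∀ u, Chain Hom u t → Chain Hom x u → V) :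
    (p.append (cons f q)).splitSum G
      = (p.splitSum fun u l r => G u l (r.append (cons f q)))
        + q.splitSum fun u l r => G u (p.append (cons f l)) r := by
  induction p with
  | nil => simp
  | cons g p ih => simp [ih, add_assoc]

/-- Both sides are the sum over all factorizations `p = l ++ m ++ r`. -/
theorem splitSum_splitSum {x y : Ob} (p : Chain Hom x y)
    (G : ∀ u v, Chain Hom u y → Chain Hom v u → Chain Hom x v → V) :
    (p.splitSum fun u l t => t.splitSum fun v m r => G u v l m r)
      = p.splitSum fun v t r => t.splitSum fun u l m => G u v l m r := by
  induction p with
  | nil => simp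
  | cons f p ih => simp [ih, splitSum_add, add_assoc]

end SplitSum

/-! ### Reversal -/

@[simp] theorem unop_nil (x : Ob) : (nil x : Chain (fun x y d => Hom y x d) x x).unop = nil x := rfl

@[simp] theorem unop_cons {x y z : Ob} {d : ℤ} (f : Hom z y d)
    (p : Chain (fun x y d => Hom y x d) x y) :
    (cons f p : Chain (fun x y d => Hom y x d) x z).unop = p.unop.append (cons f (nil z)) := rfl

@[simp] theorem unop_append {x y z : Ob} (p : Chain (fun x y d => Hom y x d) y z)
    (q : Chain (fun x y d => Hom y x d) x y) :
    (p.append q).unop = q.unop.append p.unop := by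
  induction p with
  | nil => simp
  | cons f p ih => simp [ih, append_assoc]

@[simp] theorem deg_unop {x y : Ob} (p : Chain (fun x y d => Hom y x d) x y) :
    p.unop.deg = p.deg := by
  induction p with
  | nil => simp
  | cons f p ih => simp [ih, add_comm]

theorem splitSum_unop {V : Type*} [AddCommMonoid V] {x y : Ob}
    (p : Chain (fun x y d => Hom y x d) x y) (G : ∀ u, Chain Hom u x → Chain Hom y u → V) :
    p.unop.splitSum G = p.splitSum fun u l r => G u r.unop l.unop := by
  induction p with
  | nil => simp
  | cons f p ih =>
    rw [unop_cons, splitSum_append_cons, splitSum_cons, ih, splitSum_nil, add_comm]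
    simp

end Chain

namespace AInfData

variable {k : Type w} [Field k]

theorem IsAInf.relations_splitSum {C : AInfData.{w, u, v} k} (h : C.IsAInf) {x y : C.Ob}
    (p : Chain C.Hom x y) (e : ℤ) :
    (p.splitSum fun _ l t => t.splitSum fun _ m r =>
      l.deg.negOnePow • C.b (l.append (.cons (C.b m (m.deg + 2)) r)) e) = 0 :=
  h.relations p e

theorem IsAInf.b_zero {C : AInfData.{w, u, v} k} (h : C.IsAInf) {x y z t : C.Ob} {d : ℤ}
    (l : Chain C.Hom z t) (r : Chain C.Hom x y) (e : ℤ) :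
    C.b (l.append (.cons (0 : C.Hom y z d) r)) e = 0 := by
  simpa using h.b_smul l 0 (0 : C.Hom y z d) r e

/-- `b (l, •, r)` as a linear map. -/
def IsAInf.bLin {C : AInfData.{w, u, v} k} (h : C.IsAInf) {x y z t : C.Ob}
    (l : Chain C.Hom z t) (d : ℤ) (r : Chain C.Hom x y) (e : ℤ) : C.Hom y z d →ₗ[k] C.Hom x t e where
  toFun f := C.b (l.append (.cons f r)) e
  map_add' f g := h.b_add l f g r e
  map_smul' c f := h.b_smul l c f r e

theorem IsAInf.bLin_apply {C : AInfData.{w, u, v} k} (h : C.IsAInf) {x y z t : C.Ob} {d : ℤ}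
    (l : Chain C.Hom z t) (f : C.Hom y z d) (r : Chain C.Hom x y) (e : ℤ) :
    h.bLin l d r e f = C.b (l.append (.cons f r)) e := rfl

theorem IsAInf.b_units_smul {C : AInfData.{w, u, v} k} (h : C.IsAInf) {x y z t : C.Ob} {d : ℤ}
    (l : Chain C.Hom z t) (c : ℤˣ) (f : C.Hom y z d) (r : Chain C.Hom x y) (e : ℤ) :
    C.b (l.append (.cons (c • f) r)) e = c • C.b (l.append (.cons f r)) e := by
  rw [← h.bLin_apply, ← h.bLin_apply, Units.smul_def, Units.smul_def, map_zsmul]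

/-! ### Rotation of the cyclic functionals -/

/-- The functional `⟨•, •⟩ (b_{N-1} ⊗ id) = N W_N` on the sequence `(p, g)`. -/
def Pairing.form {C : AInfData.{w, u, v} k} (P : C.Pairing) {x y : C.Ob} {e : ℤ}
    (p : Chain C.Hom y x) (g : C.Hom x y e) : k :=
  P.shifted (C.b p (p.deg + 2)) g

theorem Pairing.form_eq {C : AInfData.{w, u, v} k} (P : C.Pairing) {x y : C.Ob} {e : ℤ}
    (p : Chain C.Hom y x) (g : C.Hom x y e) :
    P.form p g = (p.deg + 2).negOnePow • P y x (p.deg + 2) e (C.b p (p.deg + 2)) g := rfl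

theorem Pairing.W_eq {C : AInfData.{w, u, v} k} (P : C.Pairing) {x y z : C.Ob} {d e : ℤ}
    (f : C.Hom z x d) (p : Chain C.Hom y z) (g : C.Hom x y e) :
    P.W f p g = ((p.length + 2 : ℕ) : k)⁻¹ * P.form (.cons f p) g := rfl

section Rotation

variable {n : ℤ} {C : AInfData.{w, u, v} k} {P : C.Pairing}

/-- Rotation by one factor. Here characteristic zero is used, to pass from `W_N` to `N W_N`. -/
theorem IsCalabiYau.form_cons [CharZero k] (h : C.IsCalabiYau n P) {x y z : C.Ob} {d e : ℤ}
    (f : C.Hom z x d) (p : Chain C.Hom y z) (g : C.Hom x y e) :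
    P.form (.cons f p) g
      = ((d - 1) * (p.deg + (e - 1))).negOnePow • P.form (p.append (.cons g (.nil x))) f := by
  -- Both sides of a rotation carry the same factor `1 / N`, which can be cancelled.
  have key : ∀ (N : ℕ) (s : ℤˣ) (a b : k),
      ((N + 2 : ℕ) : k)⁻¹ * a = s • (((N + 2 : ℕ) : k)⁻¹ * b) → a = s • b := by
    intro N s a b hab
    have hN : ((N + 2 : ℕ) : k)⁻¹ ≠ 0 := inv_ne_zero (Nat.cast_ne_zero.2 (by omega))
    rw [← mul_smul_comm] at hab
    exact mul_left_cancel₀ hN hab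
  cases p with
  | nil =>
    refine key 0 _ _ _ ?_
    simpa [Pairing.W_eq] using h.cyclic_two f g
  | cons a p =>
    refine key (p.length + 1) _ _ _ ?_
    have := h.cyclic f a p g
    rw [Pairing.W_eq, Pairing.W_eq] at this
    simpa [Chain.snoc] using this

/-- Rotation of `(l, f, r, g)` to `(r, g, l, f)`. -/
theorem IsCalabiYau.form_rotate [CharZero k] (h : C.IsCalabiYau n P) {x y z t : C.Ob} {d e : ℤ}
    (l : Chain C.Hom z x) (f : C.Hom t z d) (r : Chain C.Hom y t) (g : C.Hom x y e) :
    P.form (l.append (.cons f r)) g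
      = ((l.deg + (d - 1)) * (r.deg + (e - 1))).negOnePow •
          P.form (r.append (.cons g l)) f := by
  induction l generalizing y e with
  | nil => simpa using h.form_cons f r g
  | cons a l ih =>
    rw [Chain.cons_append, h.form_cons, Chain.append_assoc, Chain.cons_append, ih,
      Chain.append_assoc, smul_smul, ← Int.negOnePow_add]
    congr 1
    rw [Int.negOnePow_eq_iff]
    simp only [Chain.deg_append, Chain.deg_cons, Chain.deg_nil]
    rename_i d'
    exact ⟨(d' - 1) * (l.deg + (d - 1)), by ring⟩

/-- Invariance under rotation by one factor may be checked on the functionals `N W_N`. -/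
theorem IsCalabiYau.of_form_cons (hC : C.IsAInf)
    (pair_degree : ∀ (x y : C.Ob) (i j : ℤ), i + j ≠ n → P x y i j = 0)
    (nondegenerate : ∀ (x y : C.Ob) (i j : ℤ), i + j = n → (P x y i j).IsPerfPair)
    (symmetric : ∀ {x y : C.Ob} {i j : ℤ} (f : C.Hom x y i) (g : C.Hom y x j),
      P x y i j f g = (i * j).negOnePow • P y x j i g f)
    (form_cons : ∀ {x y z : C.Ob} {d e : ℤ}
      (f : C.Hom z x d) (p : Chain C.Hom y z) (g : C.Hom x y e),
      P.form (.cons f p) g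
        = ((d - 1) * (p.deg + (e - 1))).negOnePow • P.form (p.append (.cons g (.nil x))) f) :
    C.IsCalabiYau n P where
  toIsAInf := hC
  pair_degree := pair_degree
  nondegenerate := nondegenerate
  symmetric := symmetric
  cyclic_two f g := by
    rw [Pairing.W_eq, Pairing.W_eq, form_cons, mul_smul_comm]
    simp
  cyclic f a p g := by
    rw [Pairing.W_eq, Pairing.W_eq, form_cons, mul_smul_comm]
    simp [Chain.snoc]

theorem IsCalabiYau.form_eq_zero (h : C.IsCalabiYau n P) {x y : C.Ob} {e : ℤ}
    (p : Chain C.Hom y x) (g : C.Hom x y e) (hn : p.deg + 2 + e ≠ n) : P.form p g = 0 := by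
  simp [Pairing.form, Pairing.shifted, h.pair_degree _ _ _ _ hn]

end Rotation

theorem Pairing.units_smul_left {C : AInfData.{w, u, v} k} (P : C.Pairing) {x y : C.Ob}
    {i j : ℤ} (c : ℤˣ) (f : C.Hom x y i) (g : C.Hom y x j) :
    P x y i j (c • f) g = c • P x y i j f g := by
  rw [Units.smul_def, Units.smul_def, map_zsmul, LinearMap.smul_apply]

/-! ### The opposite category -/

theorem op_b {C : AInfData.{w, u, v} k} {x y : C.Ob} (p : Chain C.op.Hom x y) (e : ℤ) :
    C.op.b p e = (p.length + 1 + p.revExp : ℤ).negOnePow • C.b p.unop e := rfl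

theorem IsAInf.op {C : AInfData.{w, u, v} k} (h : C.IsAInf) : C.op.IsAInf where
  b_nil x e := by
    change _ • C.b (Chain.nil x) e = 0
    rw [h.b_nil, smul_zero]
  b_degree p e he := by
    change _ • C.b p.unop e = 0
    rw [h.b_degree _ _ (by simpa using he), smul_zero]
  b_add l f g r e := by
    simp [h.b_add, Chain.append_assoc]
  b_smul l c f r e := by
    simp [h.b_smul, Chain.append_assoc, smul_comm c]
  relations {x y} p e := by
    have key := congrArg ((p.length + 1 + p.revExp : ℤ).negOnePow • ·)
      (h.relations_splitSum p.unop e)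
    simp only [smul_zero] at key
    rw [← key, Chain.splitSum_splitSum, Chain.splitSum_unop, Chain.smul_splitSum]
    change p.splitSum (fun _ l t => t.splitSum fun _ m r => l.deg.negOnePow •
      C.op.b (l.append (.cons (C.op.b m (m.deg + 2)) r)) e) = _
    refine Chain.splitSum_congr p fun u l t hp => ?_
    rw [Chain.splitSum_unop, Chain.smul_splitSum]
    refine Chain.splitSum_congr t fun v m r ht => ?_
    subst ht hp
    rw [op_b, op_b, Chain.unop_append, Chain.unop_cons, Chain.append_assoc, Chain.cons_append,
      Chain.nil_append, h.b_units_smul, Chain.deg_unop, Chain.deg_unop, smul_smul, smul_smul,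
      smul_smul, ← Int.negOnePow_add, ← Int.negOnePow_add, ← Int.negOnePow_add]
    congr 1
    rw [Int.negOnePow_eq_iff]
    simp only [Chain.deg_append, Chain.deg_cons, Chain.length_append, Chain.length_cons,
      Chain.revExp_append, Chain.revExp_cons]
    push_cast
    exact ⟨1 + l.deg, by ring⟩

theorem Pairing.op_form {C : AInfData.{w, u, v} k} (P : C.Pairing) {x y : C.Ob} {e : ℤ}
    (p : Chain C.op.Hom y x) (g : C.op.Hom x y e) :
    P.op.form p g
      = (p.length + 1 + p.revExp : ℤ).negOnePow • P.form (C := C) p.unop (e := e) g := by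
  rw [Pairing.form_eq, Pairing.form_eq, Chain.deg_unop, op_b]
  change _ • P x y _ _ _ _ = _
  rw [Pairing.units_smul_left, smul_comm]

/-- The opposite of a Calabi–Yau category. Reversal turns the rotation that moves the leftmost
factor to the right end into its inverse. -/
theorem IsCalabiYau.op [CharZero k] {n : ℤ} {C : AInfData.{w, u, v} k} {P : C.Pairing}
    (h : C.IsCalabiYau n P) : C.op.IsCalabiYau n P.op := by
  refine .of_form_cons h.toIsAInf.op (fun x y => h.pair_degree y x)
    (fun x y => h.nondegenerate y x) (fun f g => h.symmetric f g) fun {x y z d e} f p g => ?_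
  rw [Pairing.op_form, Pairing.op_form, Chain.unop_append]
  simp only [Chain.unop_cons, Chain.unop_nil, Chain.nil_append, Chain.cons_append]
  rw [h.form_cons (C := C) (P := P), smul_smul, smul_smul, ← Int.negOnePow_add,
    ← Int.negOnePow_add]
  congr 1
  rw [Int.negOnePow_eq_iff]
  simp only [Chain.deg_cons, Chain.deg_nil, Chain.length_append, Chain.length_cons,
    Chain.length_nil, Chain.deg_unop, Chain.revExp_append, Chain.revExp_cons, Chain.revExp_nil]
  push_cast
  exact ⟨-((d - 1) * (e - 1) + p.deg * (e - 1)), by ring⟩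

/-! ### The category of shifts -/

/-- `S^{m'} φ S^{-m} ↦ φ`. -/
def shiftEquiv (C : AInfData.{w, u, v} k) (X Y : C.Ob × ℤ) (d : ℤ) :
    C.ShiftHom X Y d ≃ₗ[k] C.Hom X.1 Y.1 (d + Y.2 - X.2) :=
  LinearEquiv.refl k (C.Hom X.1 Y.1 (d + Y.2 - X.2))

section Unshift

variable {C : AInfData.{w, u, v} k}

@[simp] theorem unshift_nil (X : C.Ob × ℤ) :
    unshift (.nil X : Chain C.ShiftHom X X) = .nil X.1 := by rw [unshift]

@[simp] theorem unshift_cons {X Y Z : C.Ob × ℤ} {d : ℤ} (f : C.ShiftHom Y Z d)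
    (p : Chain C.ShiftHom X Y) :
    unshift (.cons f p) = .cons (C.shiftEquiv Y Z d f) (unshift p) := by rw [unshift]; rfl

@[simp] theorem unshift_append {X Y Z : C.Ob × ℤ} (p : Chain C.ShiftHom Y Z)
    (q : Chain C.ShiftHom X Y) : unshift (p.append q) = (unshift p).append (unshift q) := by
  induction p with
  | nil => simp
  | cons f p ih => simp [ih]

@[simp] theorem deg_unshift {X Y : C.Ob × ℤ} (p : Chain C.ShiftHom X Y) :
    (unshift p).deg = p.deg + Y.2 - X.2 := by
  induction p with
  | nil => simp
  | cons f p ih => simp [ih]; ring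

@[simp] theorem shiftExp_nil (X : C.Ob × ℤ) : shiftExp (.nil X : Chain C.ShiftHom X X) = 0 := rfl

@[simp] theorem shiftExp_cons {X Y Z : C.Ob × ℤ} {d : ℤ} (f : C.ShiftHom Y Z d)
    (p : Chain C.ShiftHom X Y) : shiftExp (.cons f p) = Z.2 + shiftExp p := rfl

@[simp] theorem shiftExp_append {X Y Z : C.Ob × ℤ} (p : Chain C.ShiftHom Y Z)
    (q : Chain C.ShiftHom X Y) : shiftExp (p.append q) = shiftExp p + shiftExp q := by
  induction p with
  | nil => simp
  | cons f p ih => simp [ih, add_assoc]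

theorem splitSum_unshift {V : Type*} [AddCommMonoid V] {X Y : C.Ob × ℤ}
    (p : Chain C.ShiftHom X Y) (G : ∀ u, Chain C.Hom u Y.1 → Chain C.Hom X.1 u → V) :
    (unshift p).splitSum G = p.splitSum fun U l r => G U.1 (unshift l) (unshift r) := by
  induction p with
  | nil => simp
  | cons f p ih => simp [ih]

theorem shiftEquiv_b {X Y : C.Ob × ℤ} (p : Chain C.ShiftHom X Y) (e : ℤ) :
    C.shiftEquiv X Y e (C.shifts.b p e)
      = (shiftExp p).negOnePow • C.b (unshift p) (e + Y.2 - X.2) := rfl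

theorem Pairing.shifts_apply (P : C.Pairing) (n : ℤ) {X Y : C.Ob × ℤ} {i j : ℤ}
    (f : C.ShiftHom X Y i) (g : C.ShiftHom Y X j) :
    P.shifts n X Y i j f g = (Y.2 * (n + 1)).negOnePow •
      P X.1 Y.1 _ _ (C.shiftEquiv X Y i f) (C.shiftEquiv Y X j g) := rfl

theorem shiftEquiv_units_smul {X Y : C.Ob × ℤ} {d : ℤ} (c : ℤˣ) (f : C.ShiftHom X Y d) :
    C.shiftEquiv X Y d (c • f) = c • C.shiftEquiv X Y d f := by
  rw [Units.smul_def, Units.smul_def, map_zsmul]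

end Unshift

theorem IsAInf.shifts {C : AInfData.{w, u, v} k} (h : C.IsAInf) : C.shifts.IsAInf where
  b_nil X e := (C.shiftEquiv X X e).injective <| by
    rw [shiftEquiv_b, unshift_nil, h.b_nil, smul_zero, map_zero]
  b_degree {X Y} p e he := (C.shiftEquiv X Y e).injective <| by
    rw [shiftEquiv_b, h.b_degree, smul_zero, map_zero]
    rw [deg_unshift]
    intro h'
    exact he (by linarith)
  b_add {X _ _ W _} l f g r e := (C.shiftEquiv X W e).injective <| by
    rw [map_add, shiftEquiv_b, shiftEquiv_b, shiftEquiv_b]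
    simp [h.b_add]
  b_smul {X _ _ W _} l c f r e := (C.shiftEquiv X W e).injective <| by
    rw [map_smul, shiftEquiv_b, shiftEquiv_b]
    simp [h.b_smul, smul_comm c]
  relations {X Y} p e := (C.shiftEquiv X Y e).injective <| by
    have key := congrArg ((shiftExp p + Y.2 : ℤ).negOnePow • ·)
      (h.relations_splitSum (unshift p) (e + Y.2 - X.2))
    simp only [smul_zero] at key
    rw [map_zero]
    refine Eq.trans ?_ key
    rw [splitSum_unshift, Chain.smul_splitSum]
    change C.shiftEquiv X Y e (p.splitSum (fun _ l t => t.splitSum fun _ m r => l.deg.negOnePow •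
      C.shifts.b (l.append (.cons (C.shifts.b m (m.deg + 2)) r)) e)) = _
    rw [Chain.map_splitSum]
    refine Chain.splitSum_congr p fun U l t hp => ?_
    rw [splitSum_unshift, Chain.smul_splitSum, Chain.map_splitSum]
    refine Chain.splitSum_congr t fun V m r ht => ?_
    subst ht hp
    have hm : (unshift m).deg + 2 = m.deg + 2 + U.2 - V.2 := by rw [deg_unshift]; ring
    rw [hm, shiftEquiv_units_smul, shiftEquiv_b, unshift_append, unshift_cons, shiftEquiv_b,
      h.b_units_smul, smul_smul, smul_smul, smul_smul, ← Int.negOnePow_add, ← Int.negOnePow_add,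
      ← Int.negOnePow_add]
    congr 1
    rw [Int.negOnePow_eq_iff, deg_unshift]
    rw [shiftExp_append, shiftExp_cons, shiftExp_append, shiftExp_append]
    exact ⟨U.2 - Y.2, by ring⟩

/-- The sign is that of the operation, times `(-1)^{m (n + 1)}` from the pairing (`m` the shift of `X`),
times `(-1)^{m - m'}` from the degrees in the shifted pairing (`m'` the shift of `Y`). -/
theorem Pairing.shifts_form {C : AInfData.{w, u, v} k} (P : C.Pairing) (n : ℤ) {X Y : C.Ob × ℤ}
    {e : ℤ} (p : Chain C.ShiftHom Y X) (g : C.ShiftHom X Y e) :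
    (P.shifts n).form p g
      = (shiftExp p + X.2 * n + Y.2).negOnePow •
        P.form (unshift p) (C.shiftEquiv X Y e g) := by
  rw [Pairing.form_eq, Pairing.form_eq]
  have hm : (unshift p).deg + 2 = p.deg + 2 + X.2 - Y.2 := by rw [deg_unshift]; ring
  rw [hm, Pairing.shifts_apply, shiftEquiv_b, Pairing.units_smul_left, smul_smul, smul_smul,
    smul_smul, ← Int.negOnePow_add, ← Int.negOnePow_add, ← Int.negOnePow_add]
  congr 1
  rw [Int.negOnePow_eq_iff]
  exact ⟨0, by ring⟩

/-- The category of shifts of a Calabi–Yau category. With `s` the difference of the two shifts that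
occur, the signs to be compared differ by an even number plus `s (s - 1)`; the total degree `n` enters
this parity through the sign in the definition of the pairing. -/
theorem IsCalabiYau.shifts [CharZero k] {n : ℤ} {C : AInfData.{w, u, v} k} {P : C.Pairing}
    (h : C.IsCalabiYau n P) : C.shifts.IsCalabiYau n (P.shifts n) := by
  refine .of_form_cons h.toIsAInf.shifts (fun X Y i j hij => ?_) (fun X Y i j hij => ?_)
    (fun {X Y i j} f g => ?_) fun {X Y Z d e} f p g => ?_
  · ext f g
    rw [Pairing.shifts_apply, h.pair_degree _ _ _ _ (by omega)]
    simp
  · have := h.nondegenerate X.1 Y.1 (i + Y.2 - X.2) (j + X.2 - Y.2) (by omega)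
    have heq : P.shifts n X Y i j = (P X.1 Y.1 (i + Y.2 - X.2) (j + X.2 - Y.2)).compl₁₂
        ((C.shiftEquiv X Y i).trans
          (DistribMulAction.toLinearEquiv k _ (Y.2 * (n + 1)).negOnePow)).toLinearMap
        (C.shiftEquiv Y X j).toLinearMap := by
      ext f g
      rw [Pairing.shifts_apply, ← Pairing.units_smul_left]
      rfl
    rw [heq]
    infer_instance
  · rw [Pairing.shifts_apply, Pairing.shifts_apply, smul_smul]
    by_cases hij : i + j = n
    · rw [h.symmetric, smul_smul, ← Int.negOnePow_add, ← Int.negOnePow_add]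
      congr 1
      subst hij
      rw [Int.negOnePow_eq_iff]
      have : Y.2 * (i + j + 1) + (i + Y.2 - X.2) * (j + X.2 - Y.2) - (i * j + X.2 * (i + j + 1))
          = 2 * ((Y.2 - X.2) * j) - (Y.2 - X.2) * (Y.2 - X.2 - 1) := by ring
      rw [this]
      exact (even_two_mul _).sub (Int.even_mul_pred_self _)
    · rw [h.pair_degree _ _ _ _ (by omega), h.pair_degree _ _ _ _ (by omega)]
      simp
  · by_cases hn : (Chain.cons f p).deg + 2 + e = n
    · rw [Pairing.shifts_form, Pairing.shifts_form, unshift_cons, h.form_cons, smul_smul, smul_smul,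
        ← Int.negOnePow_add, ← Int.negOnePow_add]
      simp only [unshift_append, unshift_cons, unshift_nil]
      congr 1
      subst hn
      rw [Int.negOnePow_eq_iff]
      simp only [deg_unshift, Chain.deg_cons, shiftExp_append,
        shiftExp_cons, shiftExp_nil]
      have : X.2 + shiftExp p + X.2 * (d - 1 + p.deg + 2 + e) + Y.2 +
            (d + X.2 - Z.2 - 1) * (p.deg + Z.2 - Y.2 + (e + Y.2 - X.2 - 1)) -
          ((d - 1) * (p.deg + (e - 1)) +
            (shiftExp p + (Y.2 + 0) + Z.2 * (d - 1 + p.deg + 2 + e) + X.2))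
          = 2 * ((X.2 - Z.2) * (p.deg + e)) - (X.2 - Z.2) * (X.2 - Z.2 - 1) := by ring
      rw [this]
      exact (even_two_mul _).sub (Int.even_mul_pred_self _)
    · rw [Pairing.shifts_form, Pairing.shifts_form, h.form_eq_zero, h.form_eq_zero]
      · simp
      all_goals
        simp only [deg_unshift, Chain.deg_append, Chain.deg_cons, Chain.deg_nil] at hn ⊢
        omega

end AInfData

/-! ### Sums over multisets -/

namespace Multiset

variable {α β V : Type*} [AddCommMonoid V]

/-- The sum of the values of `F` on the elements of `s`. -/
def mapSum (s : Multiset α) (F : α → V) : V := (s.map F).sum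

@[simp] theorem mapSum_zero (F : α → V) : (0 : Multiset α).mapSum F = 0 := by simp [mapSum]

@[simp] theorem mapSum_singleton (a : α) (F : α → V) : ({a} : Multiset α).mapSum F = F a := by
  simp [mapSum]

theorem mapSum_map (s : Multiset α) (f : α → β) (F : β → V) :
    (s.map f).mapSum F = s.mapSum fun a => F (f a) := by simp [mapSum]

theorem mapSum_bind (s : Multiset α) (f : α → Multiset β) (F : β → V) :
    (s.bind f).mapSum F = s.mapSum fun a => (f a).mapSum F := by
  simp [mapSum, map_bind, sum_bind]

theorem mapSum_val (s : Finset α) (F : α → V) : s.val.mapSum F = ∑ a ∈ s, F a := rfl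

theorem mapSum_add (s : Multiset α) (F G : α → V) :
    (s.mapSum fun a => F a + G a) = s.mapSum F + s.mapSum G := by simp [mapSum]

theorem mapSum_congr (s : Multiset α) {F G : α → V} (h : ∀ a ∈ s, F a = G a) :
    s.mapSum F = s.mapSum G := by rw [mapSum, mapSum, map_congr rfl h]

theorem mapSum_eq_zero (s : Multiset α) {F : α → V} (h : ∀ a ∈ s, F a = 0) :
    s.mapSum F = 0 := by
  rw [mapSum_congr s h]; simp [mapSum]

theorem mapSum_comm (s : Multiset α) (t : Multiset β) (F : α → β → V) :
    (s.mapSum fun a => t.mapSum (F a)) = t.mapSum fun b => s.mapSum fun a => F a b :=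
  sum_map_sum_map s t

theorem mapSum_sum (s : Multiset α) (t : Finset β) (F : α → β → V) :
    (s.mapSum fun a => ∑ b ∈ t, F a b) = ∑ b ∈ t, s.mapSum fun a => F a b :=
  mapSum_comm s t.val F

theorem map_mapSum {W Φ : Type*} [AddCommMonoid W] [FunLike Φ V W] [AddMonoidHomClass Φ V W]
    (φ : Φ) (s : Multiset α) (F : α → V) : φ (s.mapSum F) = s.mapSum fun a => φ (F a) := by
  simp [mapSum, map_multiset_sum]

theorem smul_mapSum {M V : Type*} [AddCommMonoid V] [DistribSMul M V] (c : M) (s : Multiset α)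
    (F : α → V) : c • s.mapSum F = s.mapSum fun a => c • F a :=
  map_mapSum (DistribSMul.toAddMonoidHom V c) s F

theorem mapSum_splitSum {Ob : Type u} {Hom : Ob → Ob → ℤ → Type v} (s : Multiset α) {x y : Ob}
    (p : Chain Hom x y) (G : α → ∀ u, Chain Hom u y → Chain Hom x u → V) :
    (s.mapSum fun a => p.splitSum (G a)) = p.splitSum fun u l r => s.mapSum fun a => G a u l r := by
  induction p with
  | nil => simp
  | cons f p ih => simp [ih, mapSum_add]

end Multiset

theorem Finset.sum_splitSum {α V : Type*} [AddCommMonoid V] {Ob : Type u}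
    {Hom : Ob → Ob → ℤ → Type v} (s : Finset α) {x y : Ob}
    (p : Chain Hom x y) (G : α → ∀ u, Chain Hom u y → Chain Hom x u → V) :
    ∑ a ∈ s, p.splitSum (G a) = p.splitSum fun u l r => ∑ a ∈ s, G a u l r :=
  s.val.mapSum_splitSum p G

namespace AInfData

variable {k : Type w} [Field k] {D : AInfData.{w, u, v} k}

/-- Some entry of the sequence is zero. -/
def HasZero {x y : D.Ob} (p : Chain D.Hom x y) : Prop :=
  ∃ (s t : D.Ob) (d : ℤ) (l : Chain D.Hom t y) (r : Chain D.Hom x s),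
    p = l.append (.cons (0 : D.Hom s t d) r)

theorem hasZero_cons_zero {x y z : D.Ob} {d : ℤ} (p : Chain D.Hom x y) :
    HasZero (.cons (0 : D.Hom y z d) p) := ⟨_, _, _, .nil _, p, rfl⟩

theorem HasZero.append_left {x y z : D.Ob} {q : Chain D.Hom x y} (h : HasZero q)
    (p : Chain D.Hom y z) : HasZero (p.append q) := by
  obtain ⟨s, t, d, l, r, rfl⟩ := h
  exact ⟨s, t, d, p.append l, r, (Chain.append_assoc _ _ _).symm⟩

theorem HasZero.append_right {x y z : D.Ob} {p : Chain D.Hom y z} (h : HasZero p)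
    (q : Chain D.Hom x y) : HasZero (p.append q) := by
  obtain ⟨s, t, d, l, r, rfl⟩ := h
  exact ⟨s, t, d, l, r.append q, by rw [Chain.append_assoc, Chain.cons_append]⟩

theorem HasZero.cons {x y z : D.Ob} {d : ℤ} {p : Chain D.Hom x y} (h : HasZero p)
    (f : D.Hom y z d) : HasZero (.cons f p) :=
  h.append_left (.cons f (.nil y))

theorem IsAInf.b_hasZero (h : D.IsAInf) {x y : D.Ob} {p : Chain D.Hom x y} (hp : HasZero p)
    (e : ℤ) : D.b p e = 0 := by
  obtain ⟨s, t, d, l, r, rfl⟩ := hp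
  exact h.b_zero l r e

/-! ### Sequences of entries of a sequence of matrices -/

/-- The sequences `((M_t)_{i, q_{t-1}}, …, (M_1)_{q_1, j})`, for all `q_{t-1}, …, q_1`. -/
def entries : ∀ {X Y : D.Tuple}, Chain D.MatHom X Y → (i : Fin Y.size) → (j : Fin X.size) →
    Multiset (Chain D.Hom (X.obj j) (Y.obj i))
  | _, _, .nil X, i, j => if h : i = j then {h ▸ .nil (X.obj i)} else 0
  | _, _, .cons (y := Y) M P, i, j =>
      Finset.univ.val.bind fun q : Fin Y.size => (entries P q j).map (.cons (M i q))

theorem entries_nil_self (X : D.Tuple) (i : Fin X.size) :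
    entries (.nil X) i i = {.nil (X.obj i)} := by simp [entries]

theorem entries_nil_of_ne (X : D.Tuple) {i j : Fin X.size} (h : i ≠ j) :
    entries (.nil X) i j = 0 := by simp [entries, h]

section Sums

variable {V : Type*} [AddCommMonoid V]

theorem entries_cons_mapSum {X Y Z : D.Tuple} {d : ℤ} (M : D.MatHom Y Z d)
    (P : Chain D.MatHom X Y) (i : Fin Z.size) (j : Fin X.size)
    (F : Chain D.Hom (X.obj j) (Z.obj i) → V) :
    (entries (.cons M P) i j).mapSum F
      = ∑ q, (entries P q j).mapSum fun c => F (.cons (M i q) c) := by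
  rw [entries, Multiset.mapSum_bind, Multiset.mapSum_val]
  simp only [Multiset.mapSum_map]

theorem mem_entries_cons {X Y Z : D.Tuple} {d : ℤ} {M : D.MatHom Y Z d}
    {P : Chain D.MatHom X Y} {i : Fin Z.size} {j : Fin X.size}
    {c : Chain D.Hom (X.obj j) (Z.obj i)} :
    c ∈ entries (.cons M P) i j ↔ ∃ q, ∃ c' ∈ entries P q j, .cons (M i q) c' = c := by
  simp [entries]

theorem entries_append_mapSum {X Y Z : D.Tuple} (P : Chain D.MatHom Y Z) (Q : Chain D.MatHom X Y)
    (i : Fin Z.size) (j : Fin X.size) (F : Chain D.Hom (X.obj j) (Z.obj i) → V) :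
    (entries (P.append Q) i j).mapSum F = ∑ q, (entries P i q).mapSum fun a =>
      (entries Q q j).mapSum fun c => F (a.append c) := by
  induction P with
  | nil =>
    rw [Finset.sum_eq_single i]
    · simp [entries_nil_self]
    · intro q _ hq
      simp [entries_nil_of_ne _ hq.symm]
    · simp
  | cons M P ih =>
    simp only [Chain.cons_append, entries_cons_mapSum, ih]
    rw [Finset.sum_comm]

theorem deg_of_mem_entries {X Y : D.Tuple} (P : Chain D.MatHom X Y) {i : Fin Y.size}
    {j : Fin X.size} {c : Chain D.Hom (X.obj j) (Y.obj i)} (hc : c ∈ entries P i j) :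
    c.deg = P.deg := by
  induction P with
  | nil =>
    by_cases h : i = j
    · subst h
      rw [entries_nil_self, Multiset.mem_singleton] at hc
      simp [hc]
    · simp [entries_nil_of_ne _ h] at hc
  | cons M P ih =>
    obtain ⟨q, c', hc', rfl⟩ := mem_entries_cons.1 hc
    simp [ih hc']

/-- The factorizations of the entries of `(A, …, A)`. -/
theorem entries_rep_splitSum {X : D.Tuple} {d : ℤ} (A : D.MatHom X X d) (p : ℕ)
    (i j : Fin X.size)
    (G : ∀ u, Chain D.Hom u (X.obj i) → Chain D.Hom (X.obj j) u → V) :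
    (entries (.rep A p) i j).mapSum (fun c => c.splitSum G)
      = ∑ m ∈ Finset.range (p + 1), ∑ q, (entries (.rep A m) i q).mapSum fun a =>
          (entries (.rep A (p - m)) q j).mapSum fun c => G _ a c := by
  have hnil : ∀ (i : Fin X.size) (G : ∀ u, Chain D.Hom u (X.obj i) → Chain D.Hom (X.obj j) u → V)
      (P : Chain D.MatHom X X),
      (∑ q, (entries (.nil X) i q).mapSum fun a => (entries P q j).mapSum fun c => G _ a c)
        = (entries P i j).mapSum fun c => G _ (.nil _) c := by
    intro i G P
    rw [Finset.sum_eq_single i]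
    · simp [entries_nil_self]
    · intro q _ hq
      simp [entries_nil_of_ne _ hq.symm]
    · simp
  induction p generalizing i with
  | zero =>
    simp only [Chain.rep, zero_add, Finset.range_one, Finset.sum_singleton, Nat.sub_self, hnil]
    by_cases h : i = j
    · subst h; simp [entries_nil_self]
    · simp [entries_nil_of_ne _ h]
  | succ p ih =>
    rw [Finset.sum_range_succ']
    simp only [Chain.rep, entries_cons_mapSum, Chain.splitSum_cons, Multiset.mapSum_add,
      Finset.sum_add_distrib, ih, Nat.sub_zero, Nat.add_sub_add_right]
    rw [add_comm]
    congr 1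
    · rw [Finset.sum_comm]
      exact Finset.sum_congr rfl fun _ _ => Finset.sum_comm
    · simpa only [entries_cons_mapSum] using (hnil i G (.cons A (.rep A p))).symm

end Sums

theorem entrySum_eq {V : Type v} [AddCommGroup V] {X Y : D.Tuple} (P : Chain D.MatHom X Y)
    (i : Fin Y.size) (j : Fin X.size) (F : Chain D.Hom (X.obj j) (Y.obj i) → V) :
    entrySum P i j F = (entries P i j).mapSum F := by
  induction P with
  | nil =>
    by_cases h : i = j
    · subst h; simp [entrySum, entries_nil_self]
    · simp [entrySum, entries_nil_of_ne _ h, h]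
  | cons M P ih => simp [entrySum, entries_cons_mapSum, ih]

/-! ### Insertion of the twisting matrices -/

/-- On the indices of a matrix of any size `s`, the relation `R` strictly increases some rank function
with values in `{0, …, s - 1}`. If `A i j = 0` unless `R i j`, then a product of `s` entries
`A_{i q} A_{q q'} ⋯` contains a zero. -/
def IsRanked (R : ℕ → ℕ → Prop) : Prop :=
  ∀ s : ℕ, ∃ ρ : Fin s → ℕ, (∀ i, ρ i < s) ∧ ∀ i j : Fin s, R i j → ρ i < ρ j

theorem isRanked_lt : IsRanked (· < ·) := fun _ => ⟨fun i => i, fun i => i.2, fun _ _ h => h⟩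

theorem isRanked_gt : IsRanked (· > ·) :=
  fun s => ⟨fun i => s - 1 - i, fun i => by have := i.2; dsimp only; omega, fun i j h => by
    have := i.2
    change s - 1 - (i : ℕ) < s - 1 - (j : ℕ)
    change (i : ℕ) > j at h
    omega⟩

variable {R : ℕ → ℕ → Prop}

theorem hasZero_of_mem_entries_rep (T : D.TwObj R) {ρ : Fin T.tuple.size → ℕ}
    (hρ : ∀ i j : Fin T.tuple.size, R i j → ρ i < ρ j) {p : ℕ} {i j : Fin T.tuple.size}
    (hp : ρ j < ρ i + p) {c : Chain D.Hom (T.tuple.obj j) (T.tuple.obj i)}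
    (hc : c ∈ entries (.rep T.A p) i j) : HasZero c := by
  induction p generalizing i with
  | zero =>
    have hij : i ≠ j := by rintro rfl; omega
    simp [Chain.rep, entries_nil_of_ne _ hij] at hc
  | succ p ih =>
    obtain ⟨q, c', hc', rfl⟩ := mem_entries_cons.1 hc
    by_cases hR : R i q
    · have := hρ i q hR
      exact (ih (by omega) hc').cons _
    · rw [T.triangular i q hR]
      exact hasZero_cons_zero c'

/-- The sequences `(A_t^{⊗p_t}, M_t, A_{t-1}^{⊗p_{t-1}}, …, M_1, A_0^{⊗p_0})`, for all
`p_i ≤ size T_i`. -/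
def inserts : ∀ {T T' : D.TwObj R}, Chain (D.TwHom R) T T' →
    Multiset (Chain D.MatHom T.tuple T'.tuple)
  | _, _, .nil T => (Finset.range (T.tuple.size + 1)).val.map (Chain.rep T.A)
  | _, _, .cons (z := T') M P =>
      (Finset.range (T'.tuple.size + 1)).val.bind fun p =>
        (inserts P).map fun c => (Chain.rep T'.A p).append (.cons M c)

section

variable {V : Type*} [AddCommMonoid V]

theorem inserts_nil_mapSum (T : D.TwObj R) (F : Chain D.MatHom T.tuple T.tuple → V) :
    (inserts (.nil T)).mapSum F = ∑ p ∈ Finset.range (T.tuple.size + 1), F (.rep T.A p) := by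
  rw [inserts, Multiset.mapSum_map, Multiset.mapSum_val]

theorem inserts_cons_mapSum {T₀ T₁ T₂ : D.TwObj R} {d : ℤ} (M : D.TwHom R T₁ T₂ d)
    (P : Chain (D.TwHom R) T₀ T₁) (F : Chain D.MatHom T₀.tuple T₂.tuple → V) :
    (inserts (.cons M P)).mapSum F = ∑ p ∈ Finset.range (T₂.tuple.size + 1),
      (inserts P).mapSum fun c => F ((Chain.rep T₂.A p).append (.cons M c)) := by
  rw [inserts, Multiset.mapSum_bind, Multiset.mapSum_val]
  simp only [Multiset.mapSum_map]

end

theorem insertSum_eq {V : Type v} [AddCommGroup V] {T T' : D.TwObj R}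
    (P : Chain (D.TwHom R) T T') (F : Chain D.MatHom T.tuple T'.tuple → V) :
    insertSum P F = (inserts P).mapSum F := by
  induction P with
  | nil => simp only [insertSum, inserts_nil_mapSum]
  | cons M P ih => simp only [insertSum, inserts_cons_mapSum, ih]

theorem deg_of_mem_inserts {T T' : D.TwObj R} (P : Chain (D.TwHom R) T T')
    {c : Chain D.MatHom T.tuple T'.tuple} (hc : c ∈ inserts P) : c.deg = P.deg := by
  induction P with
  | nil =>
    simp only [inserts, Multiset.mem_map] at hc
    obtain ⟨p, -, rfl⟩ := hc
    simp
  | cons M P ih =>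
    simp only [inserts, Multiset.mem_bind, Multiset.mem_map] at hc
    obtain ⟨p, -, c', hc', rfl⟩ := hc
    simp [ih hc']

/-- The sequences of entries of
`(A_t^{⊗p_t}, M_t, A_{t-1}^{⊗p_{t-1}}, …, M_1, A_0^{⊗p_0})`, for all `p_i ≤ size T_i`. -/
def expand {T T' : D.TwObj R} (P : Chain (D.TwHom R) T T') (i : Fin T'.tuple.size)
    (j : Fin T.tuple.size) : Multiset (Chain D.Hom (T.tuple.obj j) (T'.tuple.obj i)) :=
  (inserts P).bind fun c => entries c i j

theorem deg_of_mem_expand {T T' : D.TwObj R} (P : Chain (D.TwHom R) T T')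
    {i : Fin T'.tuple.size} {j : Fin T.tuple.size}
    {c : Chain D.Hom (T.tuple.obj j) (T'.tuple.obj i)} (hc : c ∈ expand P i j) :
    c.deg = P.deg := by
  obtain ⟨c', hc', h⟩ := Multiset.mem_bind.1 hc
  rw [deg_of_mem_entries _ h, deg_of_mem_inserts _ hc']

theorem tw_b_apply {T T' : D.TwObj R} (P : Chain (D.TwHom R) T T') (e : ℤ)
    (i : Fin T'.tuple.size) (j : Fin T.tuple.size) :
    (D.tw R).b P e i j = (expand P i j).mapSum fun c => D.b c e := by
  change insertSum P (fun c => matB c e) i j = _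
  rw [insertSum_eq, expand, Multiset.mapSum_bind]
  let φ : D.MatHom T.tuple T'.tuple e →+ D.Hom (T.tuple.obj j) (T'.tuple.obj i) e :=
    { toFun := fun M => M i j, map_zero' := rfl, map_add' := fun _ _ => rfl }
  refine (Multiset.map_mapSum φ (inserts P) _).trans ?_
  exact Multiset.mapSum_congr _ fun c _ => entrySum_eq c i j _

section ExpandSums

variable {V : Type*} [AddCommMonoid V]

theorem inserts_append_cons_mapSum {T₀ T₁ T₂ T₃ : D.TwObj R} {d : ℤ}
    (P : Chain (D.TwHom R) T₂ T₃) (M : D.TwHom R T₁ T₂ d) (Q : Chain (D.TwHom R) T₀ T₁)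
    (F : Chain D.MatHom T₀.tuple T₃.tuple → V) :
    (inserts (P.append (.cons M Q))).mapSum F = (inserts P).mapSum fun a =>
      (inserts Q).mapSum fun c => F (a.append (.cons M c)) := by
  induction P with
  | nil => simp only [Chain.nil_append, inserts_nil_mapSum, inserts_cons_mapSum]
  | cons N P ih =>
    simp only [Chain.cons_append, inserts_cons_mapSum, ih, Chain.append_assoc]

theorem expand_append_cons_mapSum {T₀ T₁ T₂ T₃ : D.TwObj R} {d : ℤ}
    (P : Chain (D.TwHom R) T₂ T₃) (M : D.TwHom R T₁ T₂ d) (Q : Chain (D.TwHom R) T₀ T₁)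
    (i : Fin T₃.tuple.size) (j : Fin T₀.tuple.size)
    (F : Chain D.Hom (T₀.tuple.obj j) (T₃.tuple.obj i) → V) :
    (expand (P.append (.cons M Q)) i j).mapSum F = ∑ q, ∑ q', (expand P i q).mapSum fun a =>
      (expand Q q' j).mapSum fun c => F (a.append (.cons (M q q') c)) := by
  simp only [expand, Multiset.mapSum_bind, inserts_append_cons_mapSum, entries_append_mapSum,
    entries_cons_mapSum, Multiset.mapSum_sum]
  refine Finset.sum_congr rfl fun q _ => Finset.sum_congr rfl fun q' _ =>
    Multiset.mapSum_congr _ fun a _ => ?_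
  rw [Multiset.mapSum_comm]

theorem expand_cons_mapSum {T₀ T₁ T₂ : D.TwObj R} {d : ℤ}
    (M : D.TwHom R T₁ T₂ d) (Q : Chain (D.TwHom R) T₀ T₁)
    (i : Fin T₂.tuple.size) (j : Fin T₀.tuple.size)
    (F : Chain D.Hom (T₀.tuple.obj j) (T₂.tuple.obj i) → V) :
    (expand (.cons M Q) i j).mapSum F = ∑ q, ∑ q', (expand (.nil T₂) i q).mapSum fun a =>
      (expand Q q' j).mapSum fun c => F (a.append (.cons (M q q') c)) :=
  expand_append_cons_mapSum (.nil T₂) M Q i j F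

theorem expand_nil_mapSum (T : D.TwObj R) (i j : Fin T.tuple.size)
    (F : Chain D.Hom (T.tuple.obj j) (T.tuple.obj i) → V) :
    (expand (.nil T) i j).mapSum F = ∑ p ∈ Finset.range (T.tuple.size + 1),
      (entries (.rep T.A p) i j).mapSum F := by
  rw [expand, Multiset.mapSum_bind, inserts_nil_mapSum]

theorem expand_nil_splitSum (hR : IsRanked R) (T : D.TwObj R) (i j : Fin T.tuple.size)
    (G : ∀ u, Chain D.Hom u (T.tuple.obj i) → Chain D.Hom (T.tuple.obj j) u → V)
    (hl : ∀ u l r, HasZero l → G u l r = 0) (hr : ∀ u l r, HasZero r → G u l r = 0) :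
    (expand (.nil T) i j).mapSum (fun c => c.splitSum G)
      = ∑ q, (expand (.nil T) i q).mapSum fun a => (expand (.nil T) q j).mapSum fun c =>
          G _ a c := by
  obtain ⟨ρ, hρs, hρ⟩ := hR T.tuple.size
  have hzero : ∀ a b q, T.tuple.size < a + b →
      ((entries (.rep T.A a) i q).mapSum fun x =>
        (entries (.rep T.A b) q j).mapSum fun c => G _ x c) = 0 := by
    intro a b q hab
    by_cases hq : ρ q < ρ i + a
    · exact Multiset.mapSum_eq_zero _ fun x hx => Multiset.mapSum_eq_zero _ fun c _ =>
        hl _ _ _ (hasZero_of_mem_entries_rep T hρ hq hx)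
    · have hj : ρ j < ρ q + b := by have := hρs j; omega
      exact Multiset.mapSum_eq_zero _ fun x _ => Multiset.mapSum_eq_zero _ fun c hc =>
        hr _ _ _ (hasZero_of_mem_entries_rep T hρ hj hc)
  simp only [expand_nil_mapSum, entries_rep_splitSum]
  rw [Finset.sum_range_diag_flip (T.tuple.size + 1) fun a b => ∑ q,
    (entries (.rep T.A a) i q).mapSum fun x =>
        (entries (.rep T.A b) q j).mapSum fun c => G _ x c]
  rw [Finset.sum_comm (s := Finset.univ)]
  refine Finset.sum_congr rfl fun a _ => ?_
  simp only [Multiset.mapSum_sum]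
  rw [Finset.sum_comm (s := Finset.univ)]
  refine Finset.sum_subset (fun b => ?_) fun b hb hb' => ?_
  · simp only [Finset.mem_range]; omega
  · simp only [Finset.mem_range] at hb hb'
    exact Finset.sum_eq_zero fun q _ => hzero a b q (by omega)

/-- Factorizations of the expansions of `P` are expansions of the factorizations of `P`: a cut inside
a block `A^{⊗p}` of inserted matrices is a cut of `P` at the corresponding object. On the right hand
side blocks `A^{⊗a}` and `A^{⊗b}` with `a + b > size` meet as well, but there an entry is zero. -/
theorem expand_splitSum (hR : IsRanked R) {T T' : D.TwObj R} (P : Chain (D.TwHom R) T T')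
    (i : Fin T'.tuple.size) (j : Fin T.tuple.size)
    (G : ∀ u, Chain D.Hom u (T'.tuple.obj i) → Chain D.Hom (T.tuple.obj j) u → V)
    (hl : ∀ u l r, HasZero l → G u l r = 0) (hr : ∀ u l r, HasZero r → G u l r = 0) :
    (expand P i j).mapSum (fun c => c.splitSum G)
      = P.splitSum fun _ l r => ∑ q, (expand l i q).mapSum fun a =>
          (expand r q j).mapSum fun c => G _ a c := by
  induction P with
  | nil => rw [expand_nil_splitSum hR _ i j G hl hr, Chain.splitSum_nil]
  | @cons T₁ T₂ d M P ih =>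
    rw [Chain.splitSum_cons]
    simp only [expand_cons_mapSum M, Chain.splitSum_append_cons, Multiset.mapSum_add,
      Finset.sum_add_distrib, Multiset.mapSum_sum]
    congr 1
    · simp only [Multiset.mapSum_splitSum]
      calc _ = ∑ q, ∑ q', ∑ s, (expand (.nil T₂) i s).mapSum fun l =>
              (expand (.nil T₂) s q).mapSum fun r => (expand P q' j).mapSum fun c =>
                G _ l (r.append (.cons (M q q') c)) := by
            refine Finset.sum_congr rfl fun q _ => Finset.sum_congr rfl fun q' _ => ?_
            refine expand_nil_splitSum hR T₂ i q _ (fun u l r h => ?_) (fun u l r h => ?_)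
            · exact Multiset.mapSum_eq_zero _ fun c _ => hl _ _ _ h
            · exact Multiset.mapSum_eq_zero _ fun c _ => hr _ _ _ (h.append_right _)
        _ = _ := by
            rw [Finset.sum_comm_cycle]
    · calc _ = ∑ q, ∑ q', (expand (.nil T₂) i q).mapSum fun a => P.splitSum fun _ l r => ∑ s,
              (expand l q' s).mapSum fun x => (expand r s j).mapSum fun c =>
                G _ (a.append (.cons (M q q') x)) c := by
            refine Finset.sum_congr rfl fun q _ => Finset.sum_congr rfl fun q' _ =>
              Multiset.mapSum_congr _ fun a _ => ?_
            refine ih q' _ (fun u l r h => ?_) (fun u l r h => ?_)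
            · exact hl _ _ _ ((h.cons _).append_left a)
            · exact hr _ _ _ h
        _ = _ := by
            simp only [Multiset.mapSum_splitSum, Finset.sum_splitSum, Multiset.mapSum_sum]
            exact Chain.splitSum_congr _ fun u l r _ => Finset.sum_comm_cycle

end ExpandSums

/-! ### The category of twisted objects -/

/-- For `e = 2` this is the Maurer–Cartan equation, for other `e` a matter of degree. -/
theorem tw_b_nil (h : D.IsAInf) (T : D.TwObj R) (e : ℤ) : (D.tw R).b (.nil T) e = 0 := by
  have h0 : matB (.nil T.tuple) e = (0 : D.MatHom T.tuple T.tuple e) := by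
    funext i j
    rw [matB, entrySum_eq]
    refine Multiset.mapSum_eq_zero _ fun c hc => ?_
    by_cases hij : i = j
    · subst hij
      rw [entries_nil_self, Multiset.mem_singleton] at hc
      rw [hc, h.b_nil]
    · simp [entries_nil_of_ne _ hij] at hc
  by_cases he : e = 2
  · subst he
    change insertSum (.nil T) (fun c => matB c 2) = 0
    have hA := T.maurerCartan
    rw [← Finset.Ico_add_one_right_eq_Icc] at hA
    rw [insertSum_eq, inserts_nil_mapSum, Finset.range_eq_Ico,
      Finset.sum_eq_sum_Ico_succ_bot (by omega : 0 < T.tuple.size + 1), zero_add, hA, add_zero]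
    exact h0
  · funext i j
    rw [tw_b_apply]
    refine Multiset.mapSum_eq_zero _ fun c hc => h.b_degree c e ?_
    rw [deg_of_mem_expand _ hc, Chain.deg_nil]
    omega

theorem tw_b_append_cons {T₀ T₁ T₂ T₃ : D.TwObj R} {d : ℤ}
    (l : Chain (D.TwHom R) T₂ T₃) (M : D.TwHom R T₁ T₂ d) (r : Chain (D.TwHom R) T₀ T₁) (e : ℤ)
    (i : Fin T₃.tuple.size) (j : Fin T₀.tuple.size) :
    (D.tw R).b (l.append (.cons M r)) e i j
      = ∑ q, ∑ q', (expand l i q).mapSum fun a => (expand r q' j).mapSum fun c =>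
          D.b (a.append (.cons (M q q') c)) e := by
  rw [tw_b_apply, expand_append_cons_mapSum]

/-- The relation for twisted objects is the sum over the expansions of `p` of the relation of `D`. -/
theorem tw_relations (h : D.IsAInf) (hR : IsRanked R) {T T' : D.TwObj R}
    (p : Chain (D.TwHom R) T T') (e : ℤ) :
    (p.splitSum fun _ l t => t.splitSum fun _ m r =>
      l.deg.negOnePow • (D.tw R).b (l.append (.cons ((D.tw R).b m (m.deg + 2)) r)) e) = 0 := by
  funext i j
  let φ : D.MatHom T.tuple T'.tuple e →+ D.Hom (T.tuple.obj j) (T'.tuple.obj i) e :=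
    { toFun := fun M => M i j, map_zero' := rfl, map_add' := fun _ _ => rfl }
  let H : ∀ u v, Chain D.Hom u (T'.tuple.obj i) → Chain D.Hom v u →
      Chain D.Hom (T.tuple.obj j) v → D.Hom (T.tuple.obj j) (T'.tuple.obj i) e :=
    fun u v a m c => a.deg.negOnePow • D.b (a.append (.cons (D.b m (m.deg + 2)) c)) e
  have Hl : ∀ u v a m c, HasZero a → H u v a m c = 0 := fun u v a m c ha => by
    simp only [H]
    rw [h.b_hasZero (ha.append_right _), smul_zero]
  have Hm : ∀ u v a m c, HasZero m → H u v a m c = 0 := fun u v a m c hm => by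
    simp only [H]
    rw [h.b_hasZero hm, h.b_zero, smul_zero]
  have Hr : ∀ u v a m c, HasZero c → H u v a m c = 0 := fun u v a m c hc => by
    simp only [H]
    rw [h.b_hasZero ((hc.cons _).append_left a), smul_zero]
  calc _ = φ (p.splitSum fun _ l t => t.splitSum fun _ m r => l.deg.negOnePow •
        (D.tw R).b (l.append (.cons ((D.tw R).b m (m.deg + 2)) r)) e) := rfl
    _ = p.splitSum fun _ l t => t.splitSum fun _ m r => ∑ q, (expand l i q).mapSum fun a =>
          ∑ q', (expand m q q').mapSum fun b => (expand r q' j).mapSum fun c => H _ _ a b c := by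
      rw [Chain.map_splitSum]
      refine Chain.splitSum_congr _ fun U l t _ => ?_
      rw [Chain.map_splitSum]
      refine Chain.splitSum_congr _ fun V m r _ => ?_
      change l.deg.negOnePow • (D.tw R).b _ e i j = _
      rw [tw_b_append_cons]
      generalize hB : (D.tw R).b m (m.deg + 2) = B
      simp only [Multiset.mapSum_sum, Finset.smul_sum, Multiset.smul_mapSum]
      refine Finset.sum_congr rfl fun q _ => Finset.sum_congr rfl fun q' _ =>
        Multiset.mapSum_congr _ fun a ha => ?_
      rw [Multiset.mapSum_comm]
      refine Multiset.mapSum_congr _ fun c _ => ?_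
      rw [← hB, tw_b_apply, ← h.bLin_apply, Multiset.map_mapSum, Multiset.smul_mapSum]
      refine Multiset.mapSum_congr _ fun b hb => ?_
      simp only [H]
      rw [h.bLin_apply, deg_of_mem_expand _ ha, deg_of_mem_expand _ hb]
    _ = (expand p i j).mapSum fun c => c.splitSum fun _ a t => t.splitSum fun _ b c =>
          H _ _ a b c := by
      rw [expand_splitSum hR p i j]
      · refine Chain.splitSum_congr _ fun U l t _ => ?_
        rw [← Finset.sum_splitSum]
        refine Finset.sum_congr rfl fun q _ => ?_
        rw [← Multiset.mapSum_splitSum]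
        refine Multiset.mapSum_congr _ fun a _ => ?_
        rw [expand_splitSum hR t q j]
        · exact fun _ _ _ => Hm _ _ _ _ _
        · exact fun _ _ _ => Hr _ _ _ _ _
      · exact fun _ _ _ ha => Chain.splitSum_eq_zero _ fun _ _ _ _ => Hl _ _ _ _ _ ha
      · rintro _ a t ⟨s, s', d, x, y, rfl⟩
        rw [Chain.splitSum_append_cons, Chain.splitSum_eq_zero, Chain.splitSum_eq_zero, add_zero]
        · exact fun _ l r _ => Hm _ _ _ _ _ ((hasZero_cons_zero l).append_left x)
        · exact fun _ l r _ => Hr _ _ _ _ _ ((hasZero_cons_zero y).append_left r)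
    _ = 0 := Multiset.mapSum_eq_zero _ fun c _ => h.relations_splitSum c e

theorem IsAInf.tw (h : D.IsAInf) (hR : IsRanked R) : (D.tw R).IsAInf where
  b_nil := tw_b_nil h
  b_degree {T T'} p e he := by
    funext i j
    rw [tw_b_apply]
    refine Multiset.mapSum_eq_zero _ fun c hc => h.b_degree c e ?_
    rwa [deg_of_mem_expand _ hc]
  b_add l f g r e := by
    funext i j
    refine (tw_b_append_cons l (f + g) r e i j).trans ?_
    refine Eq.trans ?_ (congrArg₂ (· + ·) (tw_b_append_cons l f r e i j)
      (tw_b_append_cons l g r e i j)).symm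
    simp only [← Finset.sum_add_distrib, ← Multiset.mapSum_add]
    refine Finset.sum_congr rfl fun q _ => Finset.sum_congr rfl fun q' _ =>
      Multiset.mapSum_congr _ fun a _ => Multiset.mapSum_congr _ fun c _ => ?_
    exact h.b_add a (f q q') (g q q') c e
  b_smul l c f r e := by
    funext i j
    refine (tw_b_append_cons l (c • f) r e i j).trans ?_
    refine Eq.trans ?_ (congrArg (c • ·) (tw_b_append_cons l f r e i j)).symm
    simp only [Finset.smul_sum, Multiset.smul_mapSum]
    refine Finset.sum_congr rfl fun q _ => Finset.sum_congr rfl fun q' _ =>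
      Multiset.mapSum_congr _ fun a _ => Multiset.mapSum_congr _ fun x _ => ?_
    exact h.b_smul a c (f q q') x e
  relations := tw_relations h hR

/-! ### The trace pairing -/

theorem Pairing.trace_apply (P : D.Pairing) (T T' : D.TwObj R) {i j : ℤ}
    (f : D.TwHom R T T' i) (g : D.TwHom R T' T j) :
    P.trace R T T' i j f g = ∑ a, ∑ c, P _ _ i j (f a c) (g c a) := rfl

theorem Pairing.trace_form (P : D.Pairing) {T T' : D.TwObj R} {e : ℤ}
    (p : Chain (D.TwHom R) T' T) (g : D.TwHom R T T' e) :
    (P.trace R).form p g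
      = ∑ a, ∑ c, (expand p a c).mapSum fun x => P.form x (g c a) := by
  rw [Pairing.form_eq, Pairing.trace_apply]
  simp only [Finset.smul_sum]
  refine Finset.sum_congr rfl fun a _ => Finset.sum_congr rfl fun c _ => ?_
  let φ : D.Hom (T'.tuple.obj c) (T.tuple.obj a) (p.deg + 2) →+ k :=
    (DistribSMul.toAddMonoidHom k (p.deg + 2).negOnePow).comp
      ((P _ _ _ e).flip (g c a)).toAddMonoidHom
  refine (congrArg φ (tw_b_apply p (p.deg + 2) a c)).trans ?_
  rw [Multiset.map_mapSum]
  refine Multiset.mapSum_congr _ fun x hx => ?_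
  rw [Pairing.form_eq, deg_of_mem_expand _ hx]
  rfl

/-- If `U a c → (V c a)*` is bijective for all `a`, `c`, then so is `∏ U a c → (∏ V c a)*`. -/
theorem bijective_of_sum_sum {α γ : Type*} [Fintype α] [DecidableEq α] [Fintype γ] [DecidableEq γ]
    {U : α → γ → Type*} {V : γ → α → Type*} [∀ a c, AddCommGroup (U a c)]
    [∀ a c, Module k (U a c)] [∀ c a, AddCommGroup (V c a)] [∀ c a, Module k (V c a)]
    (B : ∀ a c, U a c →ₗ[k] V c a →ₗ[k] k)
    (S : (∀ a c, U a c) →ₗ[k] (∀ c a, V c a) →ₗ[k] k)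
    (hS : ∀ f g, S f g = ∑ a, ∑ c, B a c (f a c) (g c a))
    (hB : ∀ a c, Function.Bijective (B a c)) : Function.Bijective S := by
  have key : ∀ f a c x, S f (Pi.single c (Pi.single a x)) = B a c (f a c) x := by
    intro f a c x
    rw [hS, Finset.sum_eq_single a, Finset.sum_eq_single c]
    · simp
    · intro c' _ hc
      simp [Pi.single_eq_of_ne hc]
    · simp
    · intro a' _ ha
      refine Finset.sum_eq_zero fun c' _ => ?_
      by_cases hc : c' = c
      · subst hc
        simp [Pi.single_eq_of_ne ha]
      · simp [Pi.single_eq_of_ne hc]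
    · simp
  constructor
  · rw [injective_iff_map_eq_zero]
    intro f hf
    funext a c
    refine (injective_iff_map_eq_zero _).1 (hB a c).1 _ (LinearMap.ext fun x => ?_)
    rw [← key, hf]
    rfl
  · intro φ
    choose f hf using fun a c => (hB a c).2
      ((φ ∘ₗ LinearMap.single k (fun c => ∀ a, V c a) c) ∘ₗ LinearMap.single k (V c) a)
    refine ⟨f, LinearMap.pi_ext' fun c => LinearMap.pi_ext' fun a => LinearMap.ext fun x => ?_⟩
    exact (key f a c x).trans (by rw [hf])

/-- A trace form is perfect if the forms on the entries are. -/
theorem Pairing.traceForm_isPerfPair (P : D.Pairing) (X Y : D.Tuple) (i j : ℤ)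
    (h : ∀ a c, (P (X.obj c) (Y.obj a) i j).IsPerfPair) : (P.traceForm X Y i j).IsPerfPair where
  bijective_left := bijective_of_sum_sum (fun a c => P (X.obj c) (Y.obj a) i j) _
    (fun _ _ => rfl) fun a c => (h a c).bijective_left
  bijective_right := bijective_of_sum_sum (fun c a => (P (X.obj c) (Y.obj a) i j).flip) _
    (fun f g => by
      change ∑ a, ∑ c, P (X.obj c) (Y.obj a) i j (g a c) (f c a) = _
      exact Finset.sum_comm)
    fun c a => (h a c).bijective_right

theorem IsCalabiYau.tw [CharZero k] {n : ℤ} {P : D.Pairing} (h : D.IsCalabiYau n P)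
    (hR : IsRanked R) : (D.tw R).IsCalabiYau n (P.trace R) := by
  refine .of_form_cons (h.toIsAInf.tw hR) (fun T T' i j hij => ?_) (fun T T' i j hij => ?_)
    (fun {T T' i j} f g => ?_) fun {T T' T'' d e} f p g => ?_
  · refine LinearMap.ext₂ fun f g => ?_
    rw [Pairing.trace_apply]
    exact Finset.sum_eq_zero fun a _ => Finset.sum_eq_zero fun c _ => by
      rw [h.pair_degree _ _ _ _ hij]; rfl
  · exact P.traceForm_isPerfPair _ _ i j fun a c => h.nondegenerate _ _ i j hij
  · rw [Pairing.trace_apply, Pairing.trace_apply, Finset.sum_comm]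
    simp only [Finset.smul_sum]
    exact Finset.sum_congr rfl fun c _ => Finset.sum_congr rfl fun a _ => h.symmetric _ _
  · -- The inserted matrices at the target of `f` travel with `f` to the right end; they have
    -- degree `0` in `Hom[1]` and do not affect the sign.
    rw [Pairing.trace_form, Pairing.trace_form]
    simp only [expand_cons_mapSum f, expand_append_cons_mapSum p g, Finset.smul_sum,
      Multiset.smul_mapSum]
    calc _ = ∑ a, ∑ c, ∑ q, ∑ q', (expand (.nil T) a q).mapSum fun l =>
            (expand p q' c).mapSum fun r =>
              ((d - 1) * (p.deg + (e - 1))).negOnePow •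
                P.form (r.append (.cons (g c a) l)) (f q q') := by
          refine Finset.sum_congr rfl fun a _ => Finset.sum_congr rfl fun c _ =>
            Finset.sum_congr rfl fun q _ => Finset.sum_congr rfl fun q' _ =>
            Multiset.mapSum_congr _ fun l hl => Multiset.mapSum_congr _ fun r hr => ?_
          rw [h.form_rotate, deg_of_mem_expand _ hl, deg_of_mem_expand _ hr, Chain.deg_nil,
            zero_add]
      _ = _ := by
          rw [Finset.sum_comm_cycle,
            Finset.sum_comm (s := (Finset.univ : Finset (Fin T''.tuple.size)))]
          refine Finset.sum_congr rfl fun q _ => ?_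
          rw [Finset.sum_comm_cycle]
          refine Finset.sum_congr rfl fun q' _ => ?_
          rw [Finset.sum_comm]
          exact Finset.sum_congr rfl fun c _ => Finset.sum_congr rfl fun a _ =>
            Multiset.mapSum_comm _ _ _

end AInfData

theorem theorem4p9 {k : Type w} [Field k] [CharZero k] (n : ℤ) (C : AInfData.{w, u, v} k)
    (P : C.Pairing) (hC : C.IsCalabiYau n P) :
    C.twLeft.IsCalabiYau n (P.twLeft n) ∧ C.twRight.IsCalabiYau n (P.twRight n) :=
  ⟨hC.op.shifts.tw AInfData.isRanked_gt, hC.shifts.tw AInfData.isRanked_lt⟩
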